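/- Fix $d\ge 1$ and $p\in(1,\infty]$. Distributions $\mathcal D$ are probability distributions over $\mathbb R^d\times\{\pm1\}$; $B_p(x,r)$ is the closed $\ell_p$ ball. A learning algorithm $A$ maps every finite sample $S\in(\mathbb R^d\times\{\pm1\})^n$, $n\ge 0$, to a classifier $A_S:\mathbb R^d\to\{\pm1\}$. Put $\mathcal L(f,\mathcal D)=P_{(x,y)\sim\mathcal D}[f(x)\ne y]$ and $\mathcal L_r(f,\mathcal D)=P_{(x,y)\sim\mathcal D}[\exists x'\in B_p(x,r): f(x')\ne y]$. The standard sample complexity $m^\epsilon(A,\mathcal D)$ (respectively, the robust sample complexity $m^\epsilon_r(A,\mathcal D)$) is the least $n$ with $\mathbb E_{S\sim\mathcal D^n}\mathcal L(A_S,\mathcal D)\le\epsilon$ (respectively, $\mathbb E_{S\sim\mathcal D^n}\mathcal L_r(A_S,\mathcal D)\le\epsilon$), and $\infty$ if there is no such $n$. Let $f_{w,b}(x)=+1$ if $\langle w,x\rangle\ge b$ and $-1$ otherwise. $\mathcal D$ is linearly $r$-separable if $\mathcal L_r(f_{w,b},\mathcal D)=0$ for some $w,b$. Let $X\subseteq\mathbb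 R^d$ be the support of the marginal of $\mathcal D$ on $\mathbb R^d$. The margin $\gamma(\mathcal D)$ is the largest real number $\gamma$ for which some $f_{w,b}$ with $\mathcal L(f_{w,b},\mathcal D)=0$ has all points of $X$ at $\ell_2$ distance at least $\gamma$ from $\{z:\langle w,z\rangle=b\}$; the aspect ratio is $\rho(\mathcal D)=\operatorname{diam}_2(X)/\gamma(\mathcal D)$. Let $\mathcal F_{r,\rho}$ be the set of linearly $r$-separable $\mathcal D$ that have a margin and satisfy $\rho(\mathcal D)\le\rho$. A max-margin algorithm (hard margin SVM) outputs, on every sample $(x_i,y_i)_{i\le n}$ for which this is possible, some $f_{w,b}$ where $(w,b)$ minimizes $\|w\|_2$ subject to $y_i(\langle w,x_i\rangle-b)\ge1$ for all $i$. Then the following hold. 1. For every $\epsilon_0\in(0,\tfrac12)$ there is a constant $c>0$, depending only on $\epsilon_0$, such that for all $d\ge1$, $p\in(1,\infty]$, $r>0$, $\rho>20$, every learning algorithm $A$ and every $\epsilon\in(0,\epsilon_0]$, there exists $\mathcal D\in\mathcal F_{r,\rho}$ with $m^\epsilon_r(A,\mathcal D)\ge \frac{c\,d}{\epsilon}$.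 2. There is an absolute constant $c'>0$ such that for all $d\ge1$, $p\in(1,\infty]$, $r>0$, $\rho>20$, every max-margin algorithm $M$, every $\mathcal D\in\mathcal F_{r,\rho}$ and every $\epsilon>0$, $m^\epsilon(M,\mathcal D)\le\frac{c'\rho^2}{\epsilon}$. -/

import Mathlib

open MeasureTheory
open scoped ENNReal RealInnerProductSpace

/-- Labels are the units `1` and `-1` of `ℤ`. -/
abbrev Label : Type := ℤˣ

instance : MeasurableSingletonClass Label where
  measurableSet_singleton y :=
    ⟨{(y : ℤ)}, measurableSet_singleton _, by ext z; simp [Units.ext_iff]⟩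

/-- The points of `ℝ^d`, with the Euclidean norm and inner product. -/
abbrev Point (d : ℕ) : Type := EuclideanSpace ℝ (Fin d)

/-- Labelled examples. -/
abbrev Example (d : ℕ) : Type := Point d × Label

/-- A classifier on `ℝ^d`. -/
abbrev Classifier (d : ℕ) : Type := Point d → Label

/-- A learning algorithm maps every finite training sample to a classifier. -/
abbrev LearningAlgorithm (d : ℕ) : Type :=
  (n : ℕ) → (Fin n → Example d) → Classifier d

noncomputable section

/-- The `ℓ_p` distance on `ℝ^d`, for an exponent `p ∈ [1, ∞]`. -/
def lpDist {d : ℕ} (p : ℝ≥0∞) (x y : Point d) : ℝ :=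
  ‖WithLp.toLp p (WithLp.ofLp (x - y))‖

/-- The standard loss: the probability that the classifier is wrong. -/
def stdLoss {d : ℕ} (f : Classifier d) (D : Measure (Example d)) : ℝ≥0∞ :=
  D {e | f e.1 ≠ e.2}

/-- The robust loss: the probability that some point of the closed `ℓ_p` ball of radius `r`
around the example is not given the label of the example. -/
def robustLoss {d : ℕ} (p : ℝ≥0∞) (r : ℝ) (f : Classifier d) (D : Measure (Example d)) :
    ℝ≥0∞ :=
  D {e | ∃ x' : Point d, lpDist p x' e.1 ≤ r ∧ f x' ≠ e.2}

/-- The expected standard loss on an i.i.d. sample of size `n`. -/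
def expStdLoss {d : ℕ} (A : LearningAlgorithm d) (D : Measure (Example d)) (n : ℕ) : ℝ≥0∞ :=
  ∫⁻ S, stdLoss (A n S) D ∂(Measure.pi fun _ : Fin n => D)

/-- The expected robust loss on an i.i.d. sample of size `n`. -/
def expRobustLoss {d : ℕ} (p : ℝ≥0∞) (r : ℝ) (A : LearningAlgorithm d)
    (D : Measure (Example d)) (n : ℕ) : ℝ≥0∞ :=
  ∫⁻ S, robustLoss p r (A n S) D ∂(Measure.pi fun _ : Fin n => D)

/-- The least number of samples for which the expected standard loss is at most `ε`
(`⊤` if there is none). -/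
def stdSampleComplexity {d : ℕ} (A : LearningAlgorithm d) (D : Measure (Example d)) (ε : ℝ) :
    ℕ∞ :=
  ⨅ (n : ℕ) (_ : expStdLoss A D n ≤ ENNReal.ofReal ε), (n : ℕ∞)

/-- The least number of samples for which the expected robust loss is at most `ε`
(`⊤` if there is none). -/
def robustSampleComplexity {d : ℕ} (p : ℝ≥0∞) (r : ℝ) (A : LearningAlgorithm d)
    (D : Measure (Example d)) (ε : ℝ) : ℕ∞ :=
  ⨅ (n : ℕ) (_ : expRobustLoss p r A D n ≤ ENNReal.ofReal ε), (n : ℕ∞)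

open Classical in
/-- The linear classifier `f_{w,b}`: label `+1` where `⟨w, x⟩ ≥ b`, label `-1` elsewhere. -/
def linearClassifier {d : ℕ} (w : Point d) (b : ℝ) : Classifier d :=
  fun x => if b ≤ ⟪w, x⟫ then 1 else -1

/-- Linear `r`-separability: some linear classifier has robust loss zero. -/
def LinearlyRSeparable {d : ℕ} (p : ℝ≥0∞) (r : ℝ) (D : Measure (Example d)) : Prop :=
  ∃ (w : Point d) (b : ℝ), robustLoss p r (linearClassifier w b) D = 0

/-- The set `S⁺ ∪ S⁻`: the support in `ℝ^d` of the distribution of the unlabelled points. -/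
def pointSupport {d : ℕ} (D : Measure (Example d)) : Set (Point d) :=
  (D.map Prod.fst).support

/-- The numbers `g` for which some perfectly accurate linear classifier has a decision boundary
at `ℓ_2` distance at least `g` from every point of the support. -/
def marginSet {d : ℕ} (D : Measure (Example d)) : Set ℝ :=
  {g | ∃ (w : Point d) (b : ℝ), stdLoss (linearClassifier w b) D = 0 ∧
    ∀ x ∈ pointSupport D, ∀ z : Point d, ⟪w, z⟫ = b → g ≤ dist x z}

/-- The distribution has margin `γ`: this is the largest element of `marginSet D`. -/
def HasMargin {d : ℕ} (D : Measure (Example d)) (γ : ℝ) : Prop :=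
  IsGreatest (marginSet D) γ

/-- The `ℓ_2` diameter of the support (possibly infinite) over the margin `γ`. -/
def aspectRatio {d : ℕ} (D : Measure (Example d)) (γ : ℝ) : ℝ≥0∞ :=
  Metric.ediam (pointSupport D) / ENNReal.ofReal γ

/-- The family `F_{r,ρ}`, with robustness measured in `ℓ_p`: the linearly `r`-separable
probability distributions that have a margin and whose aspect ratio is at most `ρ`. -/
def separatedFamily (d : ℕ) (p : ℝ≥0∞) (r ρ : ℝ) : Set (Measure (Example d)) :=
  {D | IsProbabilityMeasure D ∧ LinearlyRSeparable p r D ∧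
    ∃ γ : ℝ, HasMargin D γ ∧ aspectRatio D γ ≤ ENNReal.ofReal ρ}

/-- Feasibility for the hard margin support vector machine:
`y_i (⟨w, x_i⟩ - b) ≥ 1` for every example of the sample. -/
def HardMarginFeasible {d n : ℕ} (S : Fin n → Example d) (w : Point d) (b : ℝ) : Prop :=
  ∀ i, 1 ≤ (((S i).2 : ℤ) : ℝ) * (⟪w, (S i).1⟫ - b)

/-- Solutions of the hard margin support vector machine: feasible pairs with `‖w‖` minimal,
that is, with margin `1 / ‖w‖` maximal (on a sample with a single label, `w = 0` and the
classifier is constant). -/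
def HardMarginSolution {d n : ℕ} (S : Fin n → Example d) (w : Point d) (b : ℝ) : Prop :=
  HardMarginFeasible S w b ∧
    ∀ (w' : Point d) (b' : ℝ), HardMarginFeasible S w' b' → ‖w‖ ≤ ‖w'‖

/-- A max-margin algorithm (hard margin SVM) returns the linear classifier of a hard margin
solution on every sample that has one; its output on other samples is arbitrary. -/
def IsMaxMarginAlgorithm {d : ℕ} (M : LearningAlgorithm d) : Prop :=
  ∀ (n : ℕ) (S : Fin n → Example d), (∃ (w : Point d) (b : ℝ), HardMarginSolution S w b) →
    ∃ (w : Point d) (b : ℝ), HardMarginSolution S w b ∧ M n S = linearClassifier w b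

end

/-!
Both bounds come from elementary convex geometry and averaging.

*Upper bound.* The hard margin problem is dual to finding the closest points of the convex hulls of
the two classes (`IsDualSolution`, `exists_isDualSolution`). If the solution for all examples but
one misclassifies the remaining example, then adding that example moves the normal vector by at
least `1 / Δ`, where `Δ` bounds the diameter, and hence raises the squared norm by at least
`1 / Δ²` (`influential_of_signedMargin_nonpos`). By complementary slackness this is possible only
for an example whose dual weight is at least `‖v‖² / (2 Δ²)`, where `‖v‖`, the distance of the two
hulls, is at least twice the margin (`IsDualSolution.le_weight_of_influential`). The weights add up
to two, so at most `ρ²` examples of a sample are of this kind (`card_influential_le`). As the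
examples of an i.i.d. sample of size `n + 1` are exchangeable, the expected loss on `n` examples is
at most `ρ² / (n + 1)` (`expStdLoss_le`). The loss itself need not be a measurable function of the
sample, so the comparison goes through the increase of the least norm, which is one
(`measurable_hardMarginNorm`).

*Lower bound.* Each coordinate `i` gets two light examples of opposite labels, placed symmetrically
about a point `q_i` whose position along the vector `1` of ones depends on a parameter `k i`, at a
distance just above the robustness radius. A classifier can be robustly correct on both of them for
only one value of the parameter, because for different parameters the balls around examples of
opposite labels meet (`bothCorrect_lightExample_unique`). All points `q_i` nevertheless lie on one
hyperplane, a tilt by `O(η)` of the hyperplanes orthogonal to `1`. For `p > 1` the vector `-1` is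
the only minimiser of the sum of coordinates on its `ℓ_p` ball, so the tilt changes the robust
separation by `o(η)` only, less than the extra gap `η / 2` left between the examples and the
boundary (`exists_forall_pos_of_tilt`, `exists_hard_configuration`). A sample that misses a
coordinate carries no information about its parameter, and a guess is right with probability
`1 / m` for `m` values. As the learner may use unrelated rules for different sample sizes, one
distribution has to defeat all sizes `n < c d / ε` at once; this is why `m` is taken large compared
with the number of sizes instead of `m = 2` (`exists_forall_le_expRobustLoss`).
-/

/-! ### The dual of the hard margin problem -/

/-- The functional margin `y (⟨w, x⟩ - b)` of the labelled example `(x, y)`. -/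
noncomputable def signedMargin {d : ℕ} (w : Point d) (b : ℝ) (e : Example d) : ℝ :=
  ((e.2 : ℤ) : ℝ) * (⟪w, e.1⟫ - b)

/-- A solution of the dual of the hard margin problem: the weights `l` describe a closest pair of
points of the convex hulls of the two classes (each class has total weight one), `v` is the
difference of these two points, and `b` is the offset for which the hyperplane with normal `v`
bisects the gap between the hulls. The last field is complementary slackness. -/
structure IsDualSolution {d : ℕ} {ι : Type*} [Fintype ι] (S : ι → Example d) (l : ι → ℝ)
    (v : Point d) (b : ℝ) : Prop where
  nonneg : ∀ i, 0 ≤ l i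
  sum_eq_two : ∑ i, l i = 2
  sum_label : ∑ i, l i * (((S i).2 : ℤ) : ℝ) = 0
  combination : ∑ i, (l i * (((S i).2 : ℤ) : ℝ)) • (S i).1 = v
  margin_ge : ∀ i, ‖v‖ ^ 2 / 2 ≤ signedMargin v b (S i)
  margin_eq : ∀ i, l i ≠ 0 → signedMargin v b (S i) = ‖v‖ ^ 2 / 2

lemma label_mul_self (y : Label) : ((y : ℤ) : ℝ) * ((y : ℤ) : ℝ) = 1 := by
  rcases Int.units_eq_one_or y with rfl | rfl <;> simp

lemma abs_label (y : Label) : |((y : ℤ) : ℝ)| = 1 := by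
  rcases Int.units_eq_one_or y with rfl | rfl <;> simp

lemma label_eq_neg_of_ne {y z : Label} (h : y ≠ z) : y = -z := by
  rcases Int.units_eq_one_or y with rfl | rfl <;> rcases Int.units_eq_one_or z with rfl | rfl <;>
    simp_all

section Weights

variable {d : ℕ} {ι : Type*} [Fintype ι] {S : ι → Example d} {l : ι → ℝ} {v : Point d}

/-- Weights that are balanced between the two classes do not see the offset `b`. -/
lemma sum_mul_signedMargin (hl : ∑ i, l i * (((S i).2 : ℤ) : ℝ) = 0)
    (hv : ∑ i, (l i * (((S i).2 : ℤ) : ℝ)) • (S i).1 = v) (w : Point d) (b : ℝ) :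
    ∑ i, l i * signedMargin w b (S i) = ⟪w, v⟫ := by
  have h : ∀ i, l i * signedMargin w b (S i) =
      ⟪w, (l i * (((S i).2 : ℤ) : ℝ)) • (S i).1⟫ - b * (l i * (((S i).2 : ℤ) : ℝ)) := by
    intro i
    rw [real_inner_smul_right, signedMargin]
    ring
  simp only [h]
  rw [Finset.sum_sub_distrib, ← Finset.mul_sum, hl, ← inner_sum, hv]
  ring

/-- The weights that satisfy the constraints of the dual of the hard margin problem. -/
def dualFeasible (S : ι → Example d) : Set (ι → ℝ) :=
  {l | (∀ i, 0 ≤ l i) ∧ ∑ i, l i = 2 ∧ ∑ i, l i * (((S i).2 : ℤ) : ℝ) = 0}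

lemma isCompact_dualFeasible (S : ι → Example d) : IsCompact (dualFeasible S) := by
  refine (isCompact_univ_pi fun _ : ι => isCompact_Icc (a := (0 : ℝ)) (b := 2)).of_isClosed_subset
    ?_ ?_
  · refine IsClosed.inter ?_ (IsClosed.inter ?_ ?_)
    · have : {l : ι → ℝ | ∀ i, 0 ≤ l i} = ⋂ i, {l | 0 ≤ l i} := by ext; simp
      change IsClosed {l : ι → ℝ | ∀ i, 0 ≤ l i}
      rw [this]
      exact isClosed_iInter fun i => isClosed_le continuous_const (continuous_apply i)
    · exact isClosed_eq (by fun_prop) continuous_const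
    · exact isClosed_eq (by fun_prop) continuous_const
  · rintro l ⟨h0, h2, -⟩ i -
    exact ⟨h0 i, h2 ▸ Finset.single_le_sum (fun j _ => h0 j) (Finset.mem_univ i)⟩

lemma convex_dualFeasible (S : ι → Example d) : Convex ℝ (dualFeasible S) := by
  rintro l ⟨h0, h2, h3⟩ l' ⟨h0', h2', h3'⟩ a c ha hc hac
  refine ⟨fun i => ?_, ?_, ?_⟩
  · have := h0 i
    have := h0' i
    simp only [Pi.add_apply, Pi.smul_apply, smul_eq_mul]
    positivity
  · simp only [Pi.add_apply, Pi.smul_apply, smul_eq_mul, Finset.sum_add_distrib,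
      ← Finset.mul_sum, h2, h2']
    linear_combination 2 * hac
  · simp only [Pi.add_apply, Pi.smul_apply, smul_eq_mul, add_mul, Finset.sum_add_distrib,
      mul_assoc, ← Finset.mul_sum, h3, h3']
    ring

lemma single_add_single_mem_dualFeasible [DecidableEq ι] {i j : ι} (hi : (S i).2 = 1)
    (hj : (S j).2 = -1) :
    (Pi.single i 1 + Pi.single j 1 : ι → ℝ) ∈ dualFeasible S := by
  refine ⟨fun a => ?_, ?_, ?_⟩
  · simp only [Pi.add_apply, Pi.single_apply]
    positivity
  · simp only [Pi.add_apply, Finset.sum_add_distrib, Finset.sum_pi_single', Finset.mem_univ,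
      if_true]
    norm_num
  · simp [Pi.single_apply, add_mul, Finset.sum_add_distrib, hi, hj]

/-- The element of least norm of the difference of the two convex hulls solves the dual. -/
theorem exists_isDualSolution (S : ι → Example d) (hpos : ∃ i, (S i).2 = 1)
    (hneg : ∃ j, (S j).2 = -1) : ∃ l v b, IsDualSolution S l v b := by
  classical
  let Φ : (ι → ℝ) →ₗ[ℝ] Point d :=
    { toFun := fun l => ∑ i, (l i * (((S i).2 : ℤ) : ℝ)) • (S i).1
      map_add' := fun l l' => by simp [add_mul, add_smul, Finset.sum_add_distrib]
      map_smul' := fun a l => by simp [mul_assoc, mul_smul, Finset.smul_sum] }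
  have hΦc : Continuous Φ := Φ.continuous_of_finiteDimensional
  obtain ⟨i₁, hi₁⟩ := hpos
  obtain ⟨j₁, hj₁⟩ := hneg
  have hconv : Convex ℝ (Φ '' dualFeasible S) := (convex_dualFeasible S).linear_image Φ
  obtain ⟨v, hvK, hv⟩ := exists_norm_eq_iInf_of_complete_convex
    (Set.Nonempty.image Φ ⟨_, single_add_single_mem_dualFeasible hi₁ hj₁⟩)
    ((isCompact_dualFeasible S).image hΦc).isComplete hconv 0
  rw [norm_eq_iInf_iff_real_inner_le_zero hconv hvK] at hv
  obtain ⟨l, hl, rfl⟩ := hvK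
  obtain ⟨h0, h2, h3⟩ := hl
  set v := Φ l with hvdef
  have hcomb : ∑ i, (l i * (((S i).2 : ℤ) : ℝ)) • (S i).1 = v := rfl
  -- the first-order condition, tested on the differences of two sample points
  have hgap : ∀ i j, (S i).2 = 1 → (S j).2 = -1 → ‖v‖ ^ 2 ≤ ⟪v, (S i).1⟫ - ⟪v, (S j).1⟫ := by
    intro i j hi hj
    have h := hv _ ⟨_, single_add_single_mem_dualFeasible hi hj, rfl⟩
    have hval : Φ (Pi.single i 1 + Pi.single j 1) = (S i).1 - (S j).1 := by
      simp [Φ, Pi.single_apply, add_mul, add_smul, Finset.sum_add_distrib, hi, hj, sub_eq_add_neg]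
    rw [hval, zero_sub, inner_neg_left, inner_sub_right, inner_sub_right,
      real_inner_self_eq_norm_sq] at h
    linarith
  obtain ⟨i₀, hi₀, hmin⟩ := Finset.exists_min_image {i | (S i).2 = 1} (fun i => ⟪v, (S i).1⟫)
    ⟨i₁, by simpa using hi₁⟩
  obtain ⟨j₀, hj₀, hmax⟩ := Finset.exists_max_image {j | (S j).2 = -1} (fun j => ⟪v, (S j).1⟫)
    ⟨j₁, by simpa using hj₁⟩
  simp only [Finset.mem_filter, Finset.mem_univ, true_and] at hi₀ hj₀ hmin hmax
  have h00 := hgap i₀ j₀ hi₀ hj₀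
  set b := (⟪v, (S i₀).1⟫ + ⟪v, (S j₀).1⟫) / 2 with hb
  have hge : ∀ i, ‖v‖ ^ 2 / 2 ≤ signedMargin v b (S i) := by
    intro i
    rcases Int.units_eq_one_or (S i).2 with hi | hi
    · have := hmin i hi
      simp only [signedMargin, hi]
      push_cast
      linarith
    · have := hmax i hi
      simp only [signedMargin, hi]
      push_cast
      linarith
  refine ⟨l, v, b, h0, h2, h3, hcomb, hge, fun i hli => ?_⟩
  have hsum : ∑ i, l i * (signedMargin v b (S i) - ‖v‖ ^ 2 / 2) = 0 := by
    simp only [mul_sub, Finset.sum_sub_distrib, ← Finset.sum_mul]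
    rw [sum_mul_signedMargin h3 hcomb, h2, real_inner_self_eq_norm_sq]
    ring
  rw [Finset.sum_eq_zero_iff_of_nonneg
    (fun i _ => mul_nonneg (h0 i) (sub_nonneg.2 (hge i)))] at hsum
  have := (mul_eq_zero.1 (hsum i (Finset.mem_univ i))).resolve_left hli
  linarith

namespace IsDualSolution

variable {b : ℝ}

/-- Weak duality. -/
lemma two_mul_le_inner (h : IsDualSolution S l v b) {w : Point d} {b' g : ℝ}
    (hw : ∀ i, g ≤ signedMargin w b' (S i)) :
    2 * g ≤ ⟪w, v⟫ := by
  rw [← sum_mul_signedMargin h.sum_label h.combination w b', ← h.sum_eq_two, Finset.sum_mul]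
  exact Finset.sum_le_sum fun i _ => mul_le_mul_of_nonneg_left (hw i) (h.nonneg i)

/-- Both classes carry weight. -/
lemma exists_weight_ne_zero (h : IsDualSolution S l v b) (y : Label) :
    ∃ j, (S j).2 = y ∧ l j ≠ 0 := by
  by_contra! hne
  have hlab : ∀ j, l j * (((S j).2 : ℤ) : ℝ) = -(l j * ((y : ℤ) : ℝ)) := by
    intro j
    by_cases hj : (S j).2 = y
    · simp [hne j hj]
    · simp [label_eq_neg_of_ne hj]
  have h0 := h.sum_label
  simp only [hlab, Finset.sum_neg_distrib, ← Finset.sum_mul, h.sum_eq_two] at h0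
  rcases Int.units_eq_one_or y with rfl | rfl <;> norm_num at h0

/-- If no other example of the class of `i` carries weight, then `i` has the whole weight one of
its class. -/
lemma weight_eq_one (h : IsDualSolution S l v b) {i : ι}
    (hi : ∀ j, j ≠ i → (S j).2 = (S i).2 → l j = 0) : l i = 1 := by
  classical
  -- adding the two sum constraints doubles the weights of one class and cancels the other class
  have hs : ∑ j, (l j + l j * (((S j).2 : ℤ) : ℝ) * (((S i).2 : ℤ) : ℝ)) = 2 := by
    rw [Finset.sum_add_distrib, ← Finset.sum_mul, h.sum_label, h.sum_eq_two]
    ring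
  rw [Finset.sum_eq_single i] at hs
  · rw [mul_assoc, label_mul_self] at hs
    linarith
  · intro j _ hj
    by_cases hy : (S j).2 = (S i).2
    · simp [hi j hj hy]
    · have := label_mul_self (S i).2
      rw [label_eq_neg_of_ne hy]
      push_cast
      linear_combination (-l j) * this
  · simp

lemma norm_le (h : IsDualSolution S l v b) {Δ : ℝ}
    (hΔ : ∀ i j, dist (S i).1 (S j).1 ≤ Δ) : ‖v‖ ≤ Δ := by
  obtain ⟨i, hi, hi0⟩ := h.exists_weight_ne_zero 1
  obtain ⟨j, hj, hj0⟩ := h.exists_weight_ne_zero (-1)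
  have h1 := h.margin_eq i hi0
  have h2 := h.margin_eq j hj0
  simp only [signedMargin, hi, hj] at h1 h2
  push_cast at h1 h2
  have h3 : ‖v‖ ^ 2 = ⟪v, (S i).1 - (S j).1⟫ := by
    rw [inner_sub_right]; linarith
  have h4 := real_inner_le_norm v ((S i).1 - (S j).1)
  rw [← dist_eq_norm] at h4
  have h5 := mul_le_mul_of_nonneg_left (hΔ i j) (norm_nonneg v)
  rcases (norm_nonneg v).eq_or_lt with h0 | h0
  · rw [← h0]; exact dist_nonneg.trans (hΔ i j)
  · nlinarith

end IsDualSolution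

end Weights

/-! ### Solutions of the hard margin problem -/

lemma signedMargin_smul {d : ℕ} (a : ℝ) (w : Point d) (b : ℝ) (e : Example d) :
    signedMargin (a • w) (a * b) e = a * signedMargin w b e := by
  simp only [signedMargin, real_inner_smul_left]
  ring

lemma abs_label_mul_inner_le {d : ℕ} (y : Label) (w : Point d) {x x' : Point d} {Δ : ℝ}
    (h : dist x x' ≤ Δ) : |((y : ℤ) : ℝ) * ⟪w, x - x'⟫| ≤ ‖w‖ * Δ := by
  rw [abs_mul, abs_label, one_mul]
  refine (abs_real_inner_le_norm _ _).trans ?_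
  rw [← dist_eq_norm]
  exact mul_le_mul_of_nonneg_left h (norm_nonneg _)

section HardMargin

variable {d n : ℕ} {S : Fin n → Example d} {l : Fin n → ℝ} {v w : Point d} {b b' : ℝ}

lemma IsDualSolution.ne_zero_of_feasible (h : IsDualSolution S l v b)
    (hw : HardMarginFeasible S w b') : v ≠ 0 := by
  rintro rfl
  have := h.two_mul_le_inner hw
  simp at this
  linarith

/-- The rescaled dual solution is feasible for the hard margin problem. -/
lemma IsDualSolution.feasible_smul (h : IsDualSolution S l v b) (hv : v ≠ 0) :
    HardMarginFeasible S ((2 / ‖v‖ ^ 2) • v) (2 / ‖v‖ ^ 2 * b) := by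
  intro i
  have h0 : 0 < ‖v‖ ^ 2 := by positivity
  change 1 ≤ signedMargin _ _ _
  rw [signedMargin_smul]
  calc (1 : ℝ) = 2 / ‖v‖ ^ 2 * (‖v‖ ^ 2 / 2) := by field_simp
    _ ≤ _ := mul_le_mul_of_nonneg_left (h.margin_ge i) (by positivity)

lemma IsDualSolution.hardMarginSolution_smul (h : IsDualSolution S l v b) (hv : v ≠ 0) :
    HardMarginSolution S ((2 / ‖v‖ ^ 2) • v) (2 / ‖v‖ ^ 2 * b) := by
  refine ⟨h.feasible_smul hv, fun w' b' hw' => ?_⟩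
  have h0 : 0 < ‖v‖ := by positivity
  have h1 := (h.two_mul_le_inner hw').trans (real_inner_le_norm _ _)
  rw [norm_smul, Real.norm_of_nonneg (by positivity), div_mul_eq_mul_div,
    div_le_iff₀ (by positivity)]
  nlinarith

/-- The normal vector of a hard margin solution is determined by the dual solution. -/
lemma IsDualSolution.eq_smul (h : IsDualSolution S l v b) (hw : HardMarginSolution S w b') :
    w = (2 / ‖v‖ ^ 2) • v := by
  have hv := h.ne_zero_of_feasible hw.1
  have h0 : 0 < ‖v‖ ^ 2 := by positivity
  have h1 := hw.2 _ _ (h.feasible_smul hv)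
  have h2 := h.two_mul_le_inner hw.1
  set u := (2 / ‖v‖ ^ 2) • v with hu
  have h3 : ‖u‖ ^ 2 = 2 / ‖v‖ ^ 2 * 2 := by
    rw [hu, norm_smul, Real.norm_of_nonneg (by positivity), mul_pow]
    field_simp
  have h4 : ‖u‖ ^ 2 ≤ ⟪w, u⟫ := by
    rw [h3, hu, real_inner_smul_right]
    exact mul_le_mul_of_nonneg_left (by linarith) (by positivity)
  have h5 := norm_sub_sq_real w u
  have h6 : ‖w‖ ^ 2 ≤ ‖u‖ ^ 2 := by gcongr
  have h7 : ‖w - u‖ ^ 2 ≤ 0 := by linarith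
  rw [← sub_eq_zero, ← norm_eq_zero]
  exact pow_eq_zero_iff two_ne_zero |>.1 (le_antisymm h7 (by positivity))

lemma IsDualSolution.inner_eq_two (h : IsDualSolution S l v b) (hw : HardMarginSolution S w b') :
    ⟪w, v⟫ = 2 := by
  have hv := h.ne_zero_of_feasible hw.1
  have h0 : 0 < ‖v‖ ^ 2 := by positivity
  rw [h.eq_smul hw, real_inner_smul_left, real_inner_self_eq_norm_sq]
  field_simp

/-- Complementary slackness: the constraints of the examples that carry weight are tight. -/
lemma IsDualSolution.signedMargin_eq_one (h : IsDualSolution S l v b)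
    (hw : HardMarginSolution S w b') {i : Fin n} (hi : l i ≠ 0) :
    signedMargin w b' (S i) = 1 := by
  have hsum : ∑ i, l i * (signedMargin w b' (S i) - 1) = 0 := by
    simp only [mul_sub, Finset.sum_sub_distrib, mul_one]
    rw [sum_mul_signedMargin h.sum_label h.combination, h.sum_eq_two, h.inner_eq_two hw]
    ring
  rw [Finset.sum_eq_zero_iff_of_nonneg
    (fun i _ => mul_nonneg (h.nonneg i)
      (sub_nonneg.2 (show 1 ≤ signedMargin w b' (S i) from hw.1 i)))] at hsum
  have := (mul_eq_zero.1 (hsum i (Finset.mem_univ i))).resolve_left hi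
  linarith

/-- On a sample without the label `-y`, the constant classifier `y` solves the hard margin
problem. -/
lemma hardMarginSolution_zero {y : Label} (h : ∀ i, (S i).2 ≠ -y) :
    HardMarginSolution S 0 (-((y : ℤ) : ℝ)) := by
  refine ⟨fun i => ?_, fun w' b' _ => by simp⟩
  rw [label_eq_neg_of_ne (h i), neg_neg, inner_zero_left, zero_sub, neg_neg, label_mul_self]

lemma exists_dualSolution_or_constant (S : Fin n → Example d) :
    (∃ l v b, IsDualSolution S l v b) ∨ ∃ y : Label, ∀ i, (S i).2 ≠ -y := by
  by_cases hpos : ∃ i, (S i).2 = 1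
  · by_cases hneg : ∃ i, (S i).2 = -1
    · exact Or.inl (exists_isDualSolution S hpos hneg)
    · exact Or.inr ⟨1, by simpa using hneg⟩
  · exact Or.inr ⟨-1, by simpa using hpos⟩

theorem HardMarginFeasible.exists_solution (hw : HardMarginFeasible S w b) :
    ∃ w' b', HardMarginSolution S w' b' := by
  rcases exists_dualSolution_or_constant S with ⟨l, v, b, h⟩ | ⟨y, hy⟩
  · exact ⟨_, _, h.hardMarginSolution_smul (h.ne_zero_of_feasible hw)⟩
  · exact ⟨_, _, hardMarginSolution_zero hy⟩

/-- The value of the hard margin problem: the least norm of a feasible normal vector, and `⊤` if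
the sample is not separable. -/
noncomputable def hardMarginNorm (S : Fin n → Example d) : ℝ≥0∞ :=
  ⨅ (w : Point d) (b : ℝ) (_ : HardMarginFeasible S w b), ENNReal.ofReal ‖w‖

lemma HardMarginSolution.hardMarginNorm_eq (hw : HardMarginSolution S w b) :
    hardMarginNorm S = ENNReal.ofReal ‖w‖ :=
  le_antisymm (iInf_le_of_le w (iInf₂_le b hw.1))
    (le_iInf fun w' => le_iInf₂ fun b' h => ENNReal.ofReal_le_ofReal (hw.2 w' b' h))

/-- The value of the hard margin problem depends measurably on the sample: a feasible pair can be
scaled up to have slack and then be moved into a countable dense set. -/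
lemma measurable_hardMarginNorm (d n : ℕ) :
    Measurable (hardMarginNorm : (Fin n → Example d) → ℝ≥0∞) := by
  refine measurable_of_Iio fun a => ?_
  let q := TopologicalSpace.denseSeq (Point d × ℝ)
  have hset : hardMarginNorm ⁻¹' Set.Iio a =
      ⋃ k ∈ {k : ℕ | ENNReal.ofReal ‖(q k).1‖ < a},
        {S : Fin n → Example d | HardMarginFeasible S (q k).1 (q k).2} := by
    ext S
    simp only [Set.mem_preimage, Set.mem_Iio, Set.mem_iUnion, Set.mem_ofPred_eq, hardMarginNorm,
      iInf_lt_iff, exists_prop]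
    constructor
    · rintro ⟨w, b, hS, ha⟩
      have hnear : ∀ᶠ τ : ℝ in nhdsWithin 1 (Set.Ioi 1), ENNReal.ofReal ‖τ • w‖ < a := by
        have hc : Continuous fun τ : ℝ => ENNReal.ofReal ‖τ • w‖ :=
          ENNReal.continuous_ofReal.comp (by fun_prop)
        exact nhdsWithin_le_nhds (hc.continuousAt.eventually (gt_mem_nhds (by simpa using ha)))
      obtain ⟨τ, hτa, hτ⟩ := (hnear.and self_mem_nhdsWithin).exists
      have hopen : IsOpen {P : Point d × ℝ | ENNReal.ofReal ‖P.1‖ < a ∧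
          ∀ i, 1 < (((S i).2 : ℤ) : ℝ) * (⟪P.1, (S i).1⟫ - P.2)} := by
        refine (isOpen_lt (ENNReal.continuous_ofReal.comp (by fun_prop)) continuous_const).inter ?_
        change IsOpen {P : Point d × ℝ | ∀ i, 1 < (((S i).2 : ℤ) : ℝ) * (⟪P.1, (S i).1⟫ - P.2)}
        simp only [Set.ofPred_forall]
        exact isOpen_iInter_of_finite fun i => isOpen_lt continuous_const (by fun_prop)
      obtain ⟨k, hk⟩ := (TopologicalSpace.denseRange_denseSeq (Point d × ℝ)).exists_mem_open hopen
        ⟨(τ • w, τ * b), hτa, fun i => by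
          have h1 : 1 ≤ signedMargin w b (S i) := hS i
          change 1 < signedMargin (τ • w) (τ * b) (S i)
          rw [signedMargin_smul]
          have : (1 : ℝ) < τ := hτ
          nlinarith⟩
      exact ⟨k, hk.1, fun i => (hk.2 i).le⟩
    · rintro ⟨k, ha, hS⟩
      exact ⟨_, _, hS, ha⟩
  rw [hset]
  refine MeasurableSet.biUnion (Set.to_countable _) fun k _ => ?_
  simp only [HardMarginFeasible, Set.ofPred_forall]
  refine MeasurableSet.iInter fun i => measurableSet_le measurable_const ?_
  have hlab : Measurable fun y : Label => ((y : ℤ) : ℝ) :=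
    measurable_from_top.comp (comap_measurable _)
  exact (hlab.comp (measurable_snd.comp (measurable_pi_apply i))).mul
    (((innerSL ℝ (q k).1).measurable.comp (measurable_fst.comp (measurable_pi_apply i))).sub_const _)

end HardMargin

/-! ### Leave-one-out -/

section LeaveOneOut

variable {d n : ℕ} {T : Fin (n + 1) → Example d} {i : Fin (n + 1)} {Δ : ℝ}

/-- Removing the example `i` from the sample lowers the squared value of the hard margin problem
by at least `1 / Δ²`. -/
def Influential (Δ : ℝ) (T : Fin (n + 1) → Example d) (i : Fin (n + 1)) : Prop :=
  hardMarginNorm (fun j => T (i.succAbove j)) ^ 2 + ENNReal.ofReal (1 / Δ ^ 2) ≤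
    hardMarginNorm T ^ 2

lemma measurableSet_influential (Δ : ℝ) (i : Fin (n + 1)) :
    MeasurableSet {T : Fin (n + 1) → Example d | Influential Δ T i} := by
  refine measurableSet_le (Measurable.add_const (Measurable.pow_const ?_ 2) _)
    ((measurable_hardMarginNorm d (n + 1)).pow_const 2)
  exact (measurable_hardMarginNorm d n).comp
    (measurable_pi_iff.2 fun j => measurable_pi_apply (i.succAbove j))

lemma influential_iff {w w' : Point d} {b b' : ℝ}
    (hw : HardMarginSolution (fun j => T (i.succAbove j)) w b) (hw' : HardMarginSolution T w' b') :
    Influential Δ T i ↔ ‖w‖ ^ 2 + 1 / Δ ^ 2 ≤ ‖w'‖ ^ 2 := by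
  rw [Influential, hw.hardMarginNorm_eq, hw'.hardMarginNorm_eq,
    ← ENNReal.ofReal_pow (norm_nonneg _), ← ENNReal.ofReal_pow (norm_nonneg _),
    ← ENNReal.ofReal_add (by positivity) (by positivity),
    ENNReal.ofReal_le_ofReal_iff (by positivity)]

/-- If the solution without the example `i` misclassifies `i`, then `i` is influential: adding `i`
forces the normal vector to move by at least `1 / Δ`. The hypothesis `0 < n` excludes the empty
sample, whose solutions have an arbitrary offset. -/
theorem influential_of_signedMargin_nonpos (hn : 0 < n) (hΔ : 0 < Δ)
    (hdist : ∀ i j, dist (T i).1 (T j).1 ≤ Δ) {w w' : Point d} {b b' : ℝ}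
    (hw : HardMarginSolution (fun j => T (i.succAbove j)) w b) (hw' : HardMarginSolution T w' b')
    (herr : signedMargin w b (T i) ≤ 0) : Influential Δ T i := by
  rw [influential_iff hw hw']
  -- it suffices to move from `w` by `1 / Δ` in a direction that does not decrease the norm
  suffices h : ⟪w, w⟫ ≤ ⟪w, w'⟫ ∧ 1 ≤ ‖w' - w‖ * Δ by
    have h1 : 1 / Δ ≤ ‖w' - w‖ := by rw [div_le_iff₀ hΔ]; exact h.2
    have h2 : (1 / Δ) ^ 2 ≤ ‖w' - w‖ ^ 2 := by gcongr
    have h3 := norm_sub_sq_real w' w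
    rw [real_inner_self_eq_norm_sq, real_inner_comm] at h
    rw [one_div_pow] at h2
    linarith [h.1]
  have hfeas : HardMarginFeasible (fun j => T (i.succAbove j)) w' b' := fun j => hw'.1 _
  have hi : 1 ≤ signedMargin w' b' (T i) := hw'.1 i
  rcases exists_dualSolution_or_constant (fun j => T (i.succAbove j)) with ⟨l, v, c, h⟩ | ⟨y, hy⟩
  · constructor
    · have h1 := h.two_mul_le_inner hfeas
      have h2 := h.inner_eq_two hw
      have hv := h.ne_zero_of_feasible hfeas
      have h3 : ∀ u : Point d, ⟪w, u⟫ = 2 / ‖v‖ ^ 2 * ⟪u, v⟫ := fun u => by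
        rw [h.eq_smul hw, real_inner_smul_left, real_inner_comm]
      rw [h3 w, h3 w']
      exact mul_le_mul_of_nonneg_left (by linarith) (by positivity)
    · obtain ⟨j, hj, hj0⟩ := h.exists_weight_ne_zero (-(T i).2)
      have h1 := h.signedMargin_eq_one hw hj0
      have h2 : 1 ≤ signedMargin w' b' (T (i.succAbove j)) := hfeas j
      have h3 := (le_abs_self _).trans
        (abs_label_mul_inner_le (T i).2 (w' - w) (hdist i (i.succAbove j)))
      simp only [signedMargin, inner_sub_left, inner_sub_right, hj] at *
      push_cast at *
      linarith
  · have hw0 : w = 0 := by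
      have := hw.2 _ _ (hardMarginSolution_zero hy).1
      simpa using this
    subst hw0
    refine ⟨by simp, ?_⟩
    have h1 : 1 ≤ signedMargin 0 b (T (i.succAbove ⟨0, hn⟩)) := hw.1 ⟨0, hn⟩
    have h2 : 1 ≤ signedMargin w' b' (T (i.succAbove ⟨0, hn⟩)) := hw'.1 _
    have h3 := (le_abs_self _).trans
      (abs_label_mul_inner_le (T i).2 (w' - 0) (hdist i (i.succAbove ⟨0, hn⟩)))
    have hne : (T (i.succAbove ⟨0, hn⟩)).2 ≠ (T i).2 := by
      intro heq
      simp only [signedMargin, inner_zero_left, heq] at h1 herr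
      linarith
    simp only [signedMargin, inner_sub_right, sub_zero, label_eq_neg_of_ne hne] at *
    push_cast at *
    linarith

/-- An influential example carries a definite share of the dual weight. -/
theorem IsDualSolution.le_weight_of_influential (hΔ : 0 < Δ)
    (hdist : ∀ i j, dist (T i).1 (T j).1 ≤ Δ) {l : Fin (n + 1) → ℝ} {v w₀ : Point d} {c b₀ : ℝ}
    (h : IsDualSolution T l v c) (hw₀ : HardMarginFeasible T w₀ b₀) (hi : Influential Δ T i) :
    ‖v‖ ^ 2 ≤ 2 * Δ ^ 2 * l i := by
  have hvΔ := h.norm_le hdist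
  have hv := h.ne_zero_of_feasible hw₀
  have hv0 : 0 < ‖v‖ := by positivity
  obtain ⟨w, b, hw⟩ := hw₀.exists_solution
  have hfeas : HardMarginFeasible (fun j => T (i.succAbove j)) w b := fun j => hw.1 _
  obtain ⟨w₁, b₁, hw₁⟩ := hfeas.exists_solution
  rw [influential_iff hw₁ hw] at hi
  by_cases hone : ∀ j, j ≠ i → (T j).2 = (T i).2 → l j = 0
  · rw [h.weight_eq_one hone]
    nlinarith
  push Not at hone
  obtain ⟨j, hji, hyj, hj0⟩ := hone
  have hmarg : ∀ k, k ≠ i → 1 ≤ signedMargin w₁ b₁ (T k) := fun k hk => by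
    obtain ⟨k, rfl⟩ := Fin.exists_succAbove_eq hk
    exact hw₁.1 k
  set e := w₁ - w with he
  -- comparing `i` with a tight example of its class bounds how far its constraint is violated
  have hmi : l i * (-(‖e‖ * Δ)) ≤ l i * (signedMargin w₁ b₁ (T i) - 1) := by
    rcases eq_or_ne (l i) 0 with h0 | h0
    · simp [h0]
    refine mul_le_mul_of_nonneg_left ?_ (h.nonneg i)
    have h1 := h.signedMargin_eq_one hw h0
    have h2 := h.signedMargin_eq_one hw hj0
    have h3 := hmarg j hji
    have h4 := (neg_le_abs _).trans (abs_label_mul_inner_le (T i).2 e (hdist i j))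
    simp only [signedMargin, he, inner_sub_left, inner_sub_right, hyj] at *
    linarith
  have hev : -(l i * (‖e‖ * Δ)) ≤ ⟪e, v⟫ := by
    have h1 : l i * (signedMargin w₁ b₁ (T i) - 1) ≤
        ∑ k, l k * (signedMargin w₁ b₁ (T k) - 1) := by
      rw [← Finset.add_sum_erase _ _ (Finset.mem_univ i)]
      exact le_add_of_nonneg_right (Finset.sum_nonneg fun k hk => mul_nonneg (h.nonneg k)
        (sub_nonneg.2 (hmarg k (Finset.ne_of_mem_erase hk))))
    simp only [mul_sub, Finset.sum_sub_distrib, mul_one] at h1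
    rw [sum_mul_signedMargin h.sum_label h.combination, h.sum_eq_two] at h1
    have h2 := h.inner_eq_two hw
    rw [he, inner_sub_left, h2]
    linarith
  have hwe : ⟪w, e⟫ = 2 / ‖v‖ ^ 2 * ⟪e, v⟫ := by
    rw [h.eq_smul hw, real_inner_smul_left, real_inner_comm]
  have hexp : ‖w₁‖ ^ 2 = ‖w‖ ^ 2 + 2 * ⟪w, e⟫ + ‖e‖ ^ 2 := by
    rw [← norm_add_sq_real, he, add_sub_cancel]
  set a := 2 / ‖v‖ ^ 2 with ha
  have ha0 : 0 < a := by positivity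
  have h1 : a * -(l i * (‖e‖ * Δ)) ≤ a * ⟪e, v⟫ := mul_le_mul_of_nonneg_left hev ha0.le
  have h2 : 1 / Δ ^ 2 ≤ (a * l i * Δ) ^ 2 := by
    have := sq_nonneg (‖e‖ - a * l i * Δ)
    nlinarith
  have h3 : (1 : ℝ) ≤ (a * l i * Δ ^ 2) ^ 2 := by
    rw [div_le_iff₀ (by positivity)] at h2
    calc (1 : ℝ) ≤ _ := h2
      _ = _ := by ring
  have h4 : 1 ≤ a * l i * Δ ^ 2 := by
    have := h.nonneg i
    exact (one_le_sq_iff₀ (by positivity)).1 h3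
  rw [ha, div_mul_eq_mul_div, div_mul_eq_mul_div, le_div_iff₀ (by positivity)] at h4
  linarith

open Classical in
/-- The dual weights add up to two, so only few examples are influential. -/
theorem card_influential_le {ρ : ℝ} (hΔ : 0 < Δ) (hρ : 0 < ρ)
    (hdist : ∀ i j, dist (T i).1 (T j).1 ≤ Δ) {w : Point d} {b : ℝ}
    (hw : HardMarginFeasible T w b) (hnorm : ‖w‖ ≤ ρ / Δ) :
    (Finset.card {i | Influential Δ T i} : ℝ) ≤ ρ ^ 2 := by
  rcases exists_dualSolution_or_constant T with ⟨l, v, c, h⟩ | ⟨y, hy⟩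
  · have hv := h.ne_zero_of_feasible hw
    have hv0 : 0 < ‖v‖ := by positivity
    have h1 : (Finset.card {i | Influential Δ T i} : ℝ) * ‖v‖ ^ 2 ≤ 2 * Δ ^ 2 * 2 := by
      have h2 : 2 * Δ ^ 2 * 2 = ∑ i, 2 * Δ ^ 2 * l i := by
        rw [← Finset.mul_sum, h.sum_eq_two]
      rw [← nsmul_eq_mul, ← Finset.sum_const, h2]
      refine (Finset.sum_le_sum fun i hi =>
        h.le_weight_of_influential hΔ hdist hw (Finset.mem_filter.1 hi).2).trans ?_
      exact Finset.sum_le_univ_sum_of_nonneg fun i => by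
        have := h.nonneg i
        positivity
    have h2 : 2 * Δ ≤ ρ * ‖v‖ := by
      have h3 := (h.two_mul_le_inner hw).trans (real_inner_le_norm _ _)
      have h4 := mul_le_mul_of_nonneg_right hnorm hv0.le
      rw [div_mul_eq_mul_div, le_div_iff₀ hΔ] at h4
      nlinarith
    have h3 : (2 * Δ) ^ 2 ≤ (ρ * ‖v‖) ^ 2 := by gcongr
    rw [mul_pow ρ] at h3
    exact le_of_mul_le_mul_right (by linarith) (by positivity : 0 < ‖v‖ ^ 2)
  · have hempty : ∀ i, ¬ Influential Δ T i := by
      intro i hi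
      have h0 := (hardMarginSolution_zero hy).hardMarginNorm_eq
      rw [Influential, h0] at hi
      simp at hi
      exact absurd hi.2 hΔ.ne'
    simp [hempty]
    positivity

end LeaveOneOut

/-! ### The sample complexity of max-margin algorithms -/

section UpperBound

variable {d : ℕ} {D : Measure (Example d)}

lemma signedMargin_nonpos_of_linearClassifier_ne {w : Point d} {b : ℝ} {e : Example d}
    (h : linearClassifier w b e.1 ≠ e.2) : signedMargin w b e ≤ 0 := by
  unfold linearClassifier at h
  unfold signedMargin
  rcases Int.units_eq_one_or e.2 with he | he <;> rw [he] at h ⊢ <;> split_ifs at h <;>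
    simp_all
  linarith

lemma signedMargin_nonneg_of_linearClassifier_eq {w : Point d} {b : ℝ} {e : Example d}
    (h : linearClassifier w b e.1 = e.2) : 0 ≤ signedMargin w b e := by
  unfold linearClassifier at h
  unfold signedMargin
  rw [← h]
  split_ifs with hb <;> push_cast <;> linarith

/-- A point on the correct side at distance at least `g` from the hyperplane has functional margin
at least `g * ‖w‖`. -/
lemma mul_norm_le_signedMargin {w : Point d} {b g : ℝ} {e : Example d} (hw : w ≠ 0)
    (he : 0 ≤ signedMargin w b e) (hg : ∀ z : Point d, ⟪w, z⟫ = b → g ≤ dist e.1 z) :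
    g * ‖w‖ ≤ signedMargin w b e := by
  have h0 : 0 < ‖w‖ := by positivity
  -- test the distance on the orthogonal projection of `e.1`
  have h1 := hg (e.1 - ((⟪w, e.1⟫ - b) / ‖w‖ ^ 2) • w) (by
    rw [inner_sub_right, real_inner_smul_right, real_inner_self_eq_norm_sq]
    field_simp
    ring)
  rw [dist_eq_norm, sub_sub_cancel, norm_smul, Real.norm_eq_abs, abs_div, abs_of_nonneg
    (by positivity : 0 ≤ ‖w‖ ^ 2), div_mul_eq_mul_div, le_div_iff₀ (by positivity)] at h1
  have h2 : signedMargin w b e = |⟪w, e.1⟫ - b| := by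
    rw [← abs_of_nonneg he, signedMargin, abs_mul, abs_label, one_mul]
  rw [h2]
  nlinarith

lemma not_hasMargin_of_constant_label {γ : ℝ} (y : Label) (hy : ∀ᵐ e ∂D, e.2 = y) :
    ¬ HasMargin D γ := by
  rintro ⟨-, hub⟩
  have hmem : γ + 1 ∈ marginSet D := by
    refine ⟨0, -((y : ℤ) : ℝ), ?_, fun x _ z hz => ?_⟩
    · refine ae_iff.1 (hy.mono fun e he => ?_)
      rw [he, linearClassifier, inner_zero_left]
      rcases Int.units_eq_one_or y with rfl | rfl <;> norm_num
    · rw [inner_zero_left] at hz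
      rcases Int.units_eq_one_or y with rfl | rfl <;> norm_num at hz
  have := hub hmem
  linarith

lemma ae_fst_mem_pointSupport (D : Measure (Example d)) : ∀ᵐ e ∂D, e.1 ∈ pointSupport D :=
  ae_of_ae_map measurable_fst.aemeasurable Measure.support_mem_ae

/-- A member of the family has almost all of its points in a set of diameter at most `Δ`, and a
normal vector of norm `ρ / Δ` satisfies almost all hard margin constraints. -/
lemma exists_feasible_of_mem_separatedFamily {p : ℝ≥0∞} {r ρ : ℝ} (hρ : 0 < ρ)
    (hD : D ∈ separatedFamily d p r ρ) :
    ∃ Δ : ℝ, 0 < Δ ∧ ∃ (w : Point d) (b : ℝ), ‖w‖ ≤ ρ / Δ ∧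
      (∀ᵐ e ∂D, e.1 ∈ pointSupport D ∧ 1 ≤ signedMargin w b e) ∧
      ∀ x ∈ pointSupport D, ∀ x' ∈ pointSupport D, dist x x' ≤ Δ := by
  obtain ⟨hprob, -, γ, hγ, hasp⟩ := hD
  obtain ⟨w, b, hloss, hdist⟩ := hγ.1
  have hgood : ∀ᵐ e ∂D, e.1 ∈ pointSupport D ∧ linearClassifier w b e.1 = e.2 :=
    (ae_fst_mem_pointSupport D).and (ae_iff.2 hloss)
  rcases le_or_gt γ 0 with h0 | h0
  · -- without a positive margin the support is a single point, so there is only one label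
    exfalso
    rw [aspectRatio, ENNReal.ofReal_of_nonpos h0] at hasp
    have hdiam : Metric.ediam (pointSupport D) = 0 := by
      by_contra hne
      rw [ENNReal.div_zero hne, top_le_iff] at hasp
      exact ENNReal.ofReal_ne_top hasp
    obtain ⟨e₀, he₀⟩ := hgood.exists
    refine not_hasMargin_of_constant_label e₀.2 (hgood.mono fun e he => ?_) hγ
    rw [← he.2, ← he₀.2, Metric.ediam_eq_zero_iff.1 hdiam he.1 he₀.1]
  · have hw : w ≠ 0 := by
      rintro rfl
      refine not_hasMargin_of_constant_label (linearClassifier (0 : Point d) b 0)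
        (hgood.mono fun e he => ?_) hγ
      rw [← he.2]
      simp [linearClassifier]
    have hw0 : 0 < ‖w‖ := by positivity
    refine ⟨ρ * γ, by positivity, (1 / (γ * ‖w‖)) • w, 1 / (γ * ‖w‖) * b, ?_, ?_, ?_⟩
    · rw [norm_smul, Real.norm_of_nonneg (by positivity)]
      apply le_of_eq
      field_simp
    · refine hgood.mono fun e he => ⟨he.1, ?_⟩
      have h1 := mul_norm_le_signedMargin hw (signedMargin_nonneg_of_linearClassifier_eq he.2)
        (hdist e.1 he.1)
      rw [signedMargin_smul, div_mul_eq_mul_div, one_mul, le_div_iff₀ (by positivity), one_mul]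
      exact h1
    · intro x hx x' hx'
      rw [aspectRatio, ENNReal.div_le_iff (by simpa using h0) ENNReal.ofReal_ne_top,
        ← ENNReal.ofReal_mul hρ.le] at hasp
      have h1 := (Metric.edist_le_ediam_of_mem hx hx').trans hasp
      rwa [edist_dist, ENNReal.ofReal_le_ofReal_iff (by positivity)] at h1

lemma ae_pi_forall {Ω : Type*} [MeasurableSpace Ω] {μ : Measure Ω} [SigmaFinite μ] {n : ℕ}
    {P : Ω → Prop} (h : ∀ᵐ e ∂μ, P e) :
    ∀ᵐ S ∂Measure.pi (fun _ : Fin n => μ), ∀ j, P (S j) :=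
  Filter.eventually_all.2 fun j =>
    (Measure.tendsto_eval_ae_ae (μ := fun _ : Fin n => μ) (i := j)).eventually h

/-- The leave-one-out bound: the expected loss on a sample of size `n` is the probability that,
in a sample of size `n + 1`, a given example is misclassified by the solution for the others. -/
lemma expStdLoss_le_measure_influential [IsProbabilityMeasure D] {M : LearningAlgorithm d}
    (hM : IsMaxMarginAlgorithm M) {Δ : ℝ} (hΔ : 0 < Δ) {w : Point d} {b : ℝ}
    (hgood : ∀ᵐ e ∂D, e.1 ∈ pointSupport D ∧ 1 ≤ signedMargin w b e)
    (hdist : ∀ x ∈ pointSupport D, ∀ x' ∈ pointSupport D, dist x x' ≤ Δ)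
    {n : ℕ} (hn : 0 < n) (i : Fin (n + 1)) :
    expStdLoss M D n ≤
      Measure.pi (fun _ : Fin (n + 1) => D) {T | Influential Δ T i} := by
  have hmp := (measurePreserving_piFinSuccAbove (fun _ : Fin (n + 1) => D) i).symm
  have hB := measurableSet_influential (d := d) Δ i
  rw [← hmp.measure_preimage hB.nullMeasurableSet,
    Measure.prod_apply_symm (hmp.measurable hB), expStdLoss]
  refine lintegral_mono_ae ?_
  have hS : ∀ᵐ S ∂Measure.pi (fun _ : Fin n => D), ∀ j,
      (S j).1 ∈ pointSupport D ∧ 1 ≤ signedMargin w b (S j) :=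
    ae_pi_forall hgood
  filter_upwards [hS] with S hS
  refine measure_mono_ae (hgood.mono fun z hz herr => ?_)
  obtain ⟨w₁, b₁, hw₁, hM₁⟩ := hM n S
    (HardMarginFeasible.exists_solution (w := w) (b := b) fun j => (hS j).2)
  change M n S z.1 ≠ z.2 at herr
  rw [hM₁] at herr
  change Influential Δ (i.insertNth z S) i
  have hall : ∀ j, (i.insertNth z S : Fin (n + 1) → Example d) j ∈
      {e : Example d | e.1 ∈ pointSupport D ∧ 1 ≤ signedMargin w b e} := by
    rw [Fin.forall_iff_succAbove i]
    simpa using ⟨hz, hS⟩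
  obtain ⟨w₂, b₂, hw₂⟩ :=
    HardMarginFeasible.exists_solution (w := w) (b := b) fun j => (hall j).2
  refine influential_of_signedMargin_nonpos hn hΔ
    (fun j k => hdist _ (hall j).1 _ (hall k).1) (w := w₁) (b := b₁) ?_ hw₂ ?_
  · simpa using hw₁
  · simpa using signedMargin_nonpos_of_linearClassifier_ne herr

/-- The expected loss of a max-margin algorithm decays like `ρ² / (n + 1)`. -/
theorem expStdLoss_le {p : ℝ≥0∞} {r ρ : ℝ} (hρ : 0 < ρ) (hD : D ∈ separatedFamily d p r ρ)
    {M : LearningAlgorithm d} (hM : IsMaxMarginAlgorithm M) {n : ℕ} (hn : 0 < n) :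
    expStdLoss M D n ≤ ENNReal.ofReal (ρ ^ 2 / (n + 1)) := by
  classical
  have := hD.1
  obtain ⟨Δ, hΔ, w, b, hw, hgood, hdist⟩ := exists_feasible_of_mem_separatedFamily hρ hD
  set P := Measure.pi fun _ : Fin (n + 1) => D
  have hsum : (n + 1 : ℝ≥0∞) * expStdLoss M D n ≤ ENNReal.ofReal (ρ ^ 2) := by
    calc (n + 1 : ℝ≥0∞) * expStdLoss M D n
        = ∑ _i : Fin (n + 1), expStdLoss M D n := by simp
      _ ≤ ∑ i : Fin (n + 1), P {T | Influential Δ T i} := Finset.sum_le_sum fun i _ =>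
          expStdLoss_le_measure_influential hM hΔ hgood hdist hn i
      _ = ∫⁻ T, ∑ i : Fin (n + 1), Set.indicator {T | Influential Δ T i} 1 T ∂P := by
          rw [lintegral_finsetSum _ fun i _ =>
            measurable_one.indicator (measurableSet_influential Δ i)]
          simp only [lintegral_indicator_one (measurableSet_influential Δ _)]
      _ ≤ ∫⁻ _, ENNReal.ofReal (ρ ^ 2) ∂P := by
          refine lintegral_mono_ae ?_
          have hT : ∀ᵐ T ∂P, ∀ j, (T j).1 ∈ pointSupport D ∧ 1 ≤ signedMargin w b (T j) :=
            ae_pi_forall hgood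
          filter_upwards [hT] with T hT
          have h1 := card_influential_le hΔ hρ
            (fun j k => hdist _ (hT j).1 _ (hT k).1) (fun j => (hT j).2) hw
          calc ∑ i : Fin (n + 1), Set.indicator {T | Influential Δ T i}
                (1 : (Fin (n + 1) → Example d) → ℝ≥0∞) T
              = (Finset.card {i | Influential Δ T i} : ℝ≥0∞) := by
                simp [Set.indicator_apply]
            _ ≤ ENNReal.ofReal (ρ ^ 2) := by
                rw [← ENNReal.ofReal_natCast]
                exact ENNReal.ofReal_le_ofReal h1
      _ = ENNReal.ofReal (ρ ^ 2) := by simp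
  rw [ENNReal.ofReal_div_of_pos (by positivity), ENNReal.le_div_iff_mul_le
    (Or.inl (by rw [ne_eq, ENNReal.ofReal_eq_zero]; push Not; positivity))
    (Or.inl ENNReal.ofReal_ne_top),
    mul_comm]
  convert hsum using 2
  rw [← Nat.cast_add_one, ENNReal.ofReal_natCast, Nat.cast_add_one]

/-- The sample complexity of a max-margin algorithm is at most `ρ² / ε`. -/
theorem stdSampleComplexity_le {p : ℝ≥0∞} {r ρ : ℝ} (hρ : 1 ≤ ρ)
    (hD : D ∈ separatedFamily d p r ρ) {M : LearningAlgorithm d} (hM : IsMaxMarginAlgorithm M)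
    {ε : ℝ} (hε : 0 < ε) :
    (stdSampleComplexity M D ε : ℝ≥0∞) ≤ ENNReal.ofReal (ρ ^ 2 / ε) := by
  have := hD.1
  set n := ⌊ρ ^ 2 / ε⌋₊ with hndef
  have hfloor : (n : ℝ) ≤ ρ ^ 2 / ε := Nat.floor_le (by positivity)
  have hlt : ρ ^ 2 / ε < n + 1 := Nat.lt_floor_add_one _
  rw [div_lt_iff₀ hε] at hlt
  have hloss : expStdLoss M D n ≤ ENNReal.ofReal ε := by
    rcases Nat.eq_zero_or_pos n with h0 | h0
    · calc expStdLoss M D n ≤ ∫⁻ _, 1 ∂(Measure.pi fun _ : Fin n => D) :=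
            lintegral_mono fun S => prob_le_one
        _ = 1 := by simp
        _ ≤ ENNReal.ofReal ε := by
            rw [ENNReal.one_le_ofReal]
            rw [h0] at hlt
            push_cast at hlt
            nlinarith
    · refine (expStdLoss_le (by linarith) hD hM h0).trans (ENNReal.ofReal_le_ofReal ?_)
      rw [div_le_iff₀ (by positivity)]
      linarith
  have h1 : stdSampleComplexity M D ε ≤ n := iInf₂_le n hloss
  calc (stdSampleComplexity M D ε : ℝ≥0∞) ≤ ((n : ℕ∞) : ℝ≥0∞) := ENat.toENNReal_le.2 h1
    _ = ENNReal.ofReal n := by rw [ENat.toENNReal_coe, ENNReal.ofReal_natCast]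
    _ ≤ _ := ENNReal.ofReal_le_ofReal hfloor

end UpperBound

/-! ### Finitely supported distributions -/

section Atomic

variable {d : ℕ} {J : Type*} [Fintype J] {q : J → ℝ} {P : J → Example d}

/-- The distribution that puts the mass `q j` on the labelled example `P j`. -/
noncomputable def atomicMeasure (q : J → ℝ) (P : J → Example d) : Measure (Example d) :=
  ∑ j, ENNReal.ofReal (q j) • Measure.dirac (P j)

open Classical in
lemma atomicMeasure_apply (B : Set (Example d)) :
    atomicMeasure q P B = ∑ j, if P j ∈ B then ENNReal.ofReal (q j) else 0 := by
  simp [atomicMeasure, Measure.finsetSum_apply, Measure.dirac_apply, Set.indicator_apply]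

lemma atomicMeasure_eq_zero {B : Set (Example d)} (h : ∀ j, P j ∉ B) : atomicMeasure q P B = 0 := by
  rw [atomicMeasure_apply]
  exact Finset.sum_eq_zero fun j _ => if_neg (h j)

lemma atomicMeasure_pos {B : Set (Example d)} {j : J} (hj : P j ∈ B) (hq : 0 < q j) :
    0 < atomicMeasure q P B := by
  classical
  rw [atomicMeasure_apply]
  refine lt_of_lt_of_le ?_ (Finset.single_le_sum (fun _ _ => zero_le) (Finset.mem_univ j))
  simpa [hj] using hq

lemma isProbabilityMeasure_atomicMeasure (hq : ∀ j, 0 ≤ q j) (hsum : ∑ j, q j = 1) :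
    IsProbabilityMeasure (atomicMeasure q P) := by
  classical
  refine ⟨?_⟩
  rw [atomicMeasure_apply]
  simp only [Set.mem_univ, if_true]
  rw [← ENNReal.ofReal_sum_of_nonneg fun j _ => hq j, hsum, ENNReal.ofReal_one]

lemma pointSupport_atomicMeasure_subset :
    pointSupport (atomicMeasure q P) ⊆ Set.range fun j => (P j).1 := by
  refine Measure.support_subset_of_isClosed (Set.finite_range _).isClosed ?_
  rw [mem_ae_iff, Measure.map_apply measurable_fst (Set.finite_range _).measurableSet.compl]
  exact atomicMeasure_eq_zero fun j => by simp

lemma mem_pointSupport_atomicMeasure {j : J} (hq : 0 < q j) :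
    (P j).1 ∈ pointSupport (atomicMeasure q P) := by
  refine (Measure.mem_support_iff_forall _).2 fun U hU => ?_
  refine lt_of_lt_of_le ?_ (Measure.le_map_apply measurable_fst.aemeasurable U)
  have hj : (P j).1 ∈ U := mem_of_mem_nhds hU
  exact atomicMeasure_pos (P := P) (B := Prod.fst ⁻¹' U) hj hq

lemma linearClassifier_eq_of_signedMargin_pos {w : Point d} {b : ℝ} {e : Example d}
    (h : 0 < signedMargin w b e) : linearClassifier w b e.1 = e.2 := by
  by_contra hne
  exact absurd (signedMargin_nonpos_of_linearClassifier_ne hne) h.not_ge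

/-- A finitely supported distribution that is separated with margin `g` has a maximal margin, and
this is at least `g`: the maximal margin is half the distance of the convex hulls of the two
classes. -/
theorem exists_hasMargin_atomicMeasure (hq : ∀ j, 0 < q j) (hlab : ∀ y : Label, ∃ j, (P j).2 = y)
    {w : Point d} {b g : ℝ} (hw : w ≠ 0) (hg : 0 < g)
    (hsep : ∀ j, g * ‖w‖ ≤ signedMargin w b (P j)) :
    ∃ γ, g ≤ γ ∧ HasMargin (atomicMeasure q P) γ := by
  obtain ⟨l, v, c, h⟩ := exists_isDualSolution P (hlab 1) (hlab (-1))
  have hbound : ∀ {w : Point d} {b g : ℝ}, w ≠ 0 →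
      (∀ j, g * ‖w‖ ≤ signedMargin w b (P j)) → g ≤ ‖v‖ / 2 := by
    intro w b g hw hsep
    have h1 := (h.two_mul_le_inner hsep).trans (real_inner_le_norm w v)
    have h2 : 0 < ‖w‖ := by positivity
    nlinarith
  have hgv := hbound hw hsep
  have hv : 0 < ‖v‖ := by linarith
  refine ⟨‖v‖ / 2, hgv, ⟨v, c, ?_, ?_⟩, ?_⟩
  · refine atomicMeasure_eq_zero fun j => not_not.2 (linearClassifier_eq_of_signedMargin_pos ?_)
    have := h.margin_ge j
    have : 0 < ‖v‖ ^ 2 := by positivity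
    linarith
  · intro x hx z hz
    obtain ⟨j, rfl⟩ := pointSupport_atomicMeasure_subset hx
    have h1 := (le_abs_self _).trans
      (abs_label_mul_inner_le (P j).2 v (le_refl (dist (P j).1 z)))
    have h2 := h.margin_ge j
    rw [signedMargin, ← hz, ← inner_sub_right] at h2
    nlinarith
  · rintro g' ⟨w', b', hloss, hdist⟩
    have hcorr : ∀ j, linearClassifier w' b' (P j).1 = (P j).2 := by
      intro j
      by_contra hne
      exact (atomicMeasure_pos (B := {e | linearClassifier w' b' e.1 ≠ e.2}) hne (hq j)).ne' hloss
    have hw' : w' ≠ 0 := by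
      rintro rfl
      obtain ⟨i, hi⟩ := hlab 1
      obtain ⟨j, hj⟩ := hlab (-1)
      have h1 := hcorr i
      have h2 := hcorr j
      rw [hi] at h1
      rw [hj] at h2
      simp only [linearClassifier, inner_zero_left] at h1 h2
      rw [h1] at h2
      exact absurd h2 (by decide)
    exact hbound hw' fun j => mul_norm_le_signedMargin hw'
      (signedMargin_nonneg_of_linearClassifier_eq (hcorr j))
      (hdist _ (mem_pointSupport_atomicMeasure (hq j)))

/-- The classifier gives the label of the example to the whole closed `ℓ_p` ball around it. -/
def RobustlyCorrect (p : ℝ≥0∞) (r : ℝ) (f : Classifier d) (e : Example d) : Prop :=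
  ∀ x', lpDist p x' e.1 ≤ r → f x' = e.2

lemma robustLoss_eq {p : ℝ≥0∞} {r : ℝ} {f : Classifier d} {D : Measure (Example d)} :
    robustLoss p r f D = D {e | ¬ RobustlyCorrect p r f e} := by
  simp [robustLoss, RobustlyCorrect]

theorem atomicMeasure_mem_separatedFamily {p : ℝ≥0∞} {r ρ : ℝ} (hρ : 0 ≤ ρ) (hq : ∀ j, 0 < q j)
    (hsum : ∑ j, q j = 1) (hlab : ∀ y : Label, ∃ j, (P j).2 = y)
    {w : Point d} {b g : ℝ} (hw : w ≠ 0) (hg : 0 < g)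
    (hsep : ∀ j, g * ‖w‖ ≤ signedMargin w b (P j))
    (hrob : ∀ j, RobustlyCorrect p r (linearClassifier w b) (P j))
    (hdiam : ∀ i j, dist (P i).1 (P j).1 ≤ ρ * g) :
    atomicMeasure q P ∈ separatedFamily d p r ρ := by
  obtain ⟨γ, hgγ, hγ⟩ := exists_hasMargin_atomicMeasure hq hlab hw hg hsep
  refine ⟨isProbabilityMeasure_atomicMeasure (fun j => (hq j).le) hsum, ⟨w, b, ?_⟩, γ, hγ, ?_⟩
  · rw [robustLoss_eq]
    exact atomicMeasure_eq_zero fun j => not_not.2 (hrob j)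
  · refine ENNReal.div_le_of_le_mul ?_
    rw [← ENNReal.ofReal_mul hρ]
    refine Metric.ediam_le fun x hx x' hx' => ?_
    obtain ⟨i, rfl⟩ := pointSupport_atomicMeasure_subset hx
    obtain ⟨j, rfl⟩ := pointSupport_atomicMeasure_subset hx'
    rw [edist_dist]
    exact ENNReal.ofReal_le_ofReal
      ((hdiam i j).trans (mul_le_mul_of_nonneg_left hgγ hρ))

/-- On a finite space, the change of variables inequality holds without measurability of the
integrand. -/
lemma sum_mul_le_lintegral_map {Ω X : Type*} [Fintype Ω] [MeasurableSpace Ω]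
    [MeasurableSingletonClass Ω] [MeasurableSpace X] [MeasurableSingletonClass X] (μ : Measure Ω)
    (φ : Ω → X) (f : X → ℝ≥0∞) :
    ∑ s, f (φ s) * μ {s} ≤ ∫⁻ x, f x ∂(μ.map φ) := by
  classical
  -- cut `f` down to the finite range of `φ`, where it becomes measurable
  let F : Finset X := Finset.univ.image φ
  let g : X → ℝ≥0∞ := fun x => ∑ a ∈ F, Set.indicator {a} (fun _ => f a) x
  have hg : Measurable g :=
    Finset.measurable_sum _ fun a _ => measurable_const.indicator (measurableSet_singleton a)
  have hgval : ∀ x, g x = if x ∈ F then f x else 0 := by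
    intro x
    simp [g, Set.indicator_apply]
  calc ∑ s, f (φ s) * μ {s} = ∫⁻ s, g (φ s) ∂μ := by
        rw [lintegral_fintype]
        refine Finset.sum_congr rfl fun s _ => ?_
        rw [hgval, if_pos (Finset.mem_image_of_mem φ (Finset.mem_univ s))]
    _ = ∫⁻ x, g x ∂(μ.map φ) := (lintegral_map hg (measurable_of_finite φ)).symm
    _ ≤ ∫⁻ x, f x ∂(μ.map φ) := lintegral_mono fun x => by
        rw [hgval]
        split_ifs
        · exact le_rfl
        · exact zero_le

/-- Lower bound for the integral of an arbitrary function of an i.i.d. sample from a finitely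
supported distribution. -/
lemma sum_le_lintegral_pi_atomicMeasure (hq : ∀ j, 0 ≤ q j) (hsum : ∑ j, q j = 1) {n : ℕ}
    (f : (Fin n → Example d) → ℝ≥0∞) :
    ∑ s : Fin n → J, f (fun a => P (s a)) * ENNReal.ofReal (∏ a, q (s a)) ≤
      ∫⁻ S, f S ∂(Measure.pi fun _ : Fin n => atomicMeasure q P) := by
  classical
  let _ : MeasurableSpace J := ⊤
  let μ : Measure J := ∑ j, ENNReal.ofReal (q j) • Measure.dirac j
  have hμ : ∀ j, μ {j} = ENNReal.ofReal (q j) := by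
    intro j
    simp [μ, Measure.finsetSum_apply, Set.indicator_apply]
  have hprob : IsProbabilityMeasure μ := by
    refine ⟨?_⟩
    simp only [μ, Measure.finsetSum_apply, Measure.smul_apply, smul_eq_mul, measure_univ, mul_one]
    rw [← ENNReal.ofReal_sum_of_nonneg fun j _ => hq j, hsum, ENNReal.ofReal_one]
  have hmap : atomicMeasure q P = μ.map P := by
    ext B hB
    rw [Measure.map_apply measurable_from_top hB, atomicMeasure_apply]
    simp [μ, Measure.finsetSum_apply, Set.indicator_apply]
  have hprob' := isProbabilityMeasure_atomicMeasure (P := P) hq hsum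
  have hpi : Measure.pi (fun _ : Fin n => atomicMeasure q P) =
      (Measure.pi fun _ : Fin n => μ).map fun s a => P (s a) := by
    rw [hmap] at hprob' ⊢
    exact (Measure.pi_map_pi (μ := fun _ : Fin n => μ) (f := fun _ => P)
      fun _ => measurable_from_top.aemeasurable).symm
  rw [hpi]
  refine le_trans (le_of_eq ?_) (sum_mul_le_lintegral_map _ _ f)
  refine Finset.sum_congr rfl fun s _ => ?_
  rw [Measure.pi_singleton, ENNReal.ofReal_prod_of_nonneg fun a _ => hq _]
  simp only [hμ]

end Atomic

/-! ### The no-free-lunch argument -/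

section NoFreeLunch

variable {d m : ℕ}

/-- The atoms of the hard distributions: a heavy one for each label and, for each coordinate, a
light one for each label. -/
abbrev Atom (d : ℕ) : Type := Label ⊕ Fin d × Label

/-- The masses of the atoms: `ℓ` for the light ones, and equal masses that add up to the rest for
the two heavy ones. -/
noncomputable def atomMass (ℓ : ℝ) : Atom d → ℝ
  | Sum.inl _ => (1 - 2 * (d * ℓ)) / 2
  | Sum.inr _ => ℓ

/-- Arrangement of the atoms given the points `H y` for the heavy ones and, for the parameters `k`,
the points `Z (k i) i y` for the light ones. -/
def atomExample (H : Label → Example d) (Z : Fin m → Fin d → Label → Example d)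
    (k : Fin d → Fin m) : Atom d → Example d
  | Sum.inl y => H y
  | Sum.inr a => Z (k a.1) a.1 a.2

lemma sum_atomMass (ℓ : ℝ) : ∑ j : Atom d, atomMass ℓ j = 1 := by
  rw [Fintype.sum_sum_type, Fintype.sum_prod_type]
  simp only [atomMass, Finset.sum_const, Finset.card_univ, Fintype.card_fin,
    Fintype.card_units_int, nsmul_eq_mul]
  push_cast
  ring

/-- The masses of the atoms without the two light atoms of the coordinate `i`. -/
noncomputable def atomMassOff (ℓ : ℝ) (i : Fin d) : Atom d → ℝ
  | Sum.inl y => atomMass ℓ (Sum.inl y : Atom d)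
  | Sum.inr a => if a.1 = i then 0 else ℓ

lemma sum_atomMassOff (ℓ : ℝ) (i : Fin d) : ∑ j, atomMassOff ℓ i j = 1 - 2 * ℓ := by
  rw [← sum_atomMass (d := d) ℓ, eq_sub_iff_add_eq, Fintype.sum_sum_type, Fintype.sum_prod_type,
    Fintype.sum_sum_type, Fintype.sum_prod_type, add_assoc]
  have hi : 2 * ℓ = ∑ x : Fin d, ∑ _y : Label, if x = i then ℓ else 0 := by
    simp
  rw [hi, ← Finset.sum_add_distrib]
  simp only [← Finset.sum_add_distrib, atomMassOff, atomMass]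
  congr 1
  refine Finset.sum_congr rfl fun x _ => Finset.sum_congr rfl fun y _ => ?_
  split_ifs <;> simp

lemma atomMassOff_nonneg {ℓ : ℝ} (hℓ : 0 ≤ ℓ) (hd : 2 * (d * ℓ) ≤ 1) (i : Fin d) (j : Atom d) :
    0 ≤ atomMassOff ℓ i j := by
  rcases j with y | a
  · simp only [atomMassOff, atomMass]
    linarith
  · simp only [atomMassOff]
    split_ifs <;> linarith

lemma atomMassOff_le {ℓ : ℝ} (hℓ : 0 ≤ ℓ) (i : Fin d) (j : Atom d) :
    atomMassOff ℓ i j ≤ atomMass ℓ j := by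
  rcases j with y | a
  · exact le_rfl
  · simp only [atomMassOff, atomMass]
    split_ifs <;> linarith

variable {p : ℝ≥0∞} {r ℓ : ℝ} {H : Label → Example d} {Z : Fin m → Fin d → Label → Example d}

/-- Both light atoms of the coordinate `i` are robustly classified correctly. -/
def BothCorrect (p : ℝ≥0∞) (r : ℝ) (Z : Fin m → Fin d → Label → Example d) (f : Classifier d)
    (i : Fin d) (κ : Fin m) : Prop :=
  ∀ y, RobustlyCorrect p r f (Z κ i y)

open Classical in
/-- The robust loss is at least `ℓ` for each coordinate with an atom that is not robustly
classified correctly. -/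
lemma ofReal_sum_le_robustLoss (hℓ : 0 ≤ ℓ) (f : Classifier d) (k : Fin d → Fin m) :
    ENNReal.ofReal (∑ i, ℓ * (1 - if BothCorrect p r Z f i (k i) then 1 else 0)) ≤
      robustLoss p r f (atomicMeasure (atomMass ℓ) (atomExample H Z k)) := by
  rw [robustLoss_eq, atomicMeasure_apply, Fintype.sum_sum_type, Fintype.sum_prod_type,
    ENNReal.ofReal_sum_of_nonneg (fun i _ => mul_nonneg hℓ (by split_ifs <;> norm_num))]
  refine le_add_of_nonneg_of_le zero_le (Finset.sum_le_sum fun i _ => ?_)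
  by_cases h : BothCorrect p r Z f i (k i)
  · simp [h]
  · have h' := h
    simp only [BothCorrect, not_forall] at h'
    obtain ⟨y, hy⟩ := h'
    rw [if_neg h, sub_zero, mul_one]
    refine le_trans ?_ (Finset.single_le_sum (fun _ _ => zero_le) (Finset.mem_univ y))
    rw [if_pos (by simpa [atomExample] using hy)]
    rfl

open Classical in
/-- The probability that a sample of size `n` misses the coordinate `i` and both atoms of this
coordinate are nevertheless classified correctly. -/
noncomputable def luckyProb (p : ℝ≥0∞) (r ℓ : ℝ) (H : Label → Example d)
    (Z : Fin m → Fin d → Label → Example d) (A : LearningAlgorithm d) (k : Fin d → Fin m) (n : ℕ)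
    (i : Fin d) : ℝ :=
  ∑ s : Fin n → Atom d, (∏ a, atomMassOff ℓ i (s a)) *
    if BothCorrect p r Z (A n fun a => atomExample H Z k (s a)) i (k i) then 1 else 0

/-- The robust loss is caused by the coordinates that the sample misses, up to luck. -/
lemma ofReal_le_expRobustLoss (hℓ : 0 ≤ ℓ) (hd : 2 * (d * ℓ) ≤ 1) (A : LearningAlgorithm d)
    (k : Fin d → Fin m) (n : ℕ) :
    ENNReal.ofReal (ℓ * ∑ i, ((1 - 2 * ℓ) ^ n - luckyProb p r ℓ H Z A k n i)) ≤
      expRobustLoss p r A (atomicMeasure (atomMass ℓ) (atomExample H Z k)) n := by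
  classical
  have hq : ∀ j : Atom d, 0 ≤ atomMass ℓ j := by
    rintro (y | a)
    · simp only [atomMass]
      linarith
    · exact hℓ
  refine le_trans ?_ (sum_le_lintegral_pi_atomicMeasure hq (sum_atomMass ℓ) _)
  set u : (Fin n → Atom d) → Fin d → ℝ := fun s i =>
    1 - if BothCorrect p r Z (A n fun a => atomExample H Z k (s a)) i (k i) then 1 else 0 with hu
  have hu0 : ∀ s i, 0 ≤ u s i := fun s i => by
    simp only [hu]
    split_ifs <;> norm_num
  have hpow : ∀ i : Fin d, (1 - 2 * ℓ) ^ n = ∑ s : Fin n → Atom d, ∏ a, atomMassOff ℓ i (s a) :=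
    fun i => by rw [← sum_atomMassOff ℓ i, Fintype.sum_pow]
  have hlucky : ∀ i, (1 - 2 * ℓ) ^ n - luckyProb p r ℓ H Z A k n i =
      ∑ s : Fin n → Atom d, (∏ a, atomMassOff ℓ i (s a)) * u s i := by
    intro i
    rw [hpow i, luckyProb, ← Finset.sum_sub_distrib]
    exact Finset.sum_congr rfl fun s _ => by rw [hu]; ring
  calc ENNReal.ofReal (ℓ * ∑ i, ((1 - 2 * ℓ) ^ n - luckyProb p r ℓ H Z A k n i))
      ≤ ENNReal.ofReal (∑ s : Fin n → Atom d, (∑ i, ℓ * u s i) * ∏ a, atomMass ℓ (s a)) := by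
        refine ENNReal.ofReal_le_ofReal ?_
        simp only [hlucky]
        rw [Finset.sum_comm, Finset.mul_sum]
        refine Finset.sum_le_sum fun s _ => ?_
        rw [Finset.mul_sum, Finset.sum_mul]
        refine Finset.sum_le_sum fun i _ => ?_
        have hprod : ∏ a, atomMassOff ℓ i (s a) ≤ ∏ a, atomMass ℓ (s a) :=
          Finset.prod_le_prod (fun a _ => atomMassOff_nonneg hℓ hd i _)
            fun a _ => atomMassOff_le hℓ i _
        have h1 := mul_le_mul_of_nonneg_left hprod (mul_nonneg hℓ (hu0 s i))
        linarith
    _ ≤ _ := by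
        rw [ENNReal.ofReal_sum_of_nonneg fun s _ => mul_nonneg
          (Finset.sum_nonneg fun i _ => mul_nonneg hℓ (hu0 s i))
          (Finset.prod_nonneg fun a _ => hq _)]
        refine Finset.sum_le_sum fun s _ => ?_
        rw [ENNReal.ofReal_mul (Finset.sum_nonneg fun i _ => mul_nonneg hℓ (hu0 s i))]
        gcongr
        exact ofReal_sum_le_robustLoss hℓ _ k

open Classical in
/-- A sample that misses the coordinate `i` does not depend on `k i`, and a classifier can be
correct for only one value of `k i`. -/
lemma mul_card_bothCorrect_le
    (hZ : ∀ f i κ κ', BothCorrect p r Z f i κ → BothCorrect p r Z f i κ' → κ = κ')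
    (A : LearningAlgorithm d) {n : ℕ} (i : Fin d) (s : Fin n → Atom d)
    (hs : ∀ a y, s a ≠ Sum.inr (i, y)) :
    m * Finset.card {k : Fin d → Fin m |
      BothCorrect p r Z (A n fun a => atomExample H Z k (s a)) i (k i)} ≤
        Fintype.card (Fin d → Fin m) := by
  set R : Finset (Fin d → Fin m) := {k |
    BothCorrect p r Z (A n fun a => atomExample H Z k (s a)) i (k i)} with hR
  have hcard : m * R.card = ((Finset.univ : Finset (Fin m)) ×ˢ R).card := by
    rw [Finset.card_product, Finset.card_univ, Fintype.card_fin]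
  rw [hcard, ← Finset.card_univ]
  refine Finset.card_le_card_of_injOn (fun x => Function.update x.2 i x.1) (fun _ _ => by simp) ?_
  rintro ⟨κ, k⟩ hk ⟨κ', k'⟩ hk' heq
  simp only [Finset.coe_product, Set.mem_prod, Finset.mem_coe, hR, Finset.mem_filter,
    Finset.mem_univ, true_and] at hk hk'
  have hoff : ∀ j, j ≠ i → k j = k' j := fun j hj => by
    have := congrFun heq j
    simpa [Function.update_of_ne hj] using this
  have hκ : κ = κ' := by simpa using congrFun heq i
  have hsample : (fun a => atomExample H Z k (s a)) = fun a => atomExample H Z k' (s a) := by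
    funext a
    rcases h : s a with y | ⟨j, y⟩
    · rfl
    · have hj : j ≠ i := by
        rintro rfl
        exact hs a y h
      simp [atomExample, hoff j hj]
  rw [hsample] at hk
  have hi := hZ _ _ _ _ hk hk'
  rw [hκ]
  congr 1
  funext j
  by_cases hj : j = i
  · rw [hj, hi]
  · exact hoff j hj

/-- On average over the parameters, luck has probability at most `1 / m`. -/
lemma mul_sum_luckyProb_le (hℓ : 0 ≤ ℓ) (hd : 2 * (d * ℓ) ≤ 1) (hℓ1 : 2 * ℓ ≤ 1)
    (hZ : ∀ f i κ κ', BothCorrect p r Z f i κ → BothCorrect p r Z f i κ' → κ = κ')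
    (A : LearningAlgorithm d) (n : ℕ) (i : Fin d) :
    m * ∑ k, luckyProb p r ℓ H Z A k n i ≤ Fintype.card (Fin d → Fin m) := by
  classical
  simp only [luckyProb]
  rw [Finset.sum_comm, Finset.mul_sum]
  have hW : ∀ s : Fin n → Atom d, 0 ≤ ∏ a, atomMassOff ℓ i (s a) := fun s =>
    Finset.prod_nonneg fun a _ => atomMassOff_nonneg hℓ hd i _
  calc _ ≤ ∑ s : Fin n → Atom d, (∏ a, atomMassOff ℓ i (s a)) *
        (Fintype.card (Fin d → Fin m) : ℝ) := by
        refine Finset.sum_le_sum fun s _ => ?_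
        rw [← Finset.mul_sum, mul_left_comm]
        rcases (hW s).eq_or_lt with h0 | h0
        · rw [← h0, zero_mul, zero_mul]
        · refine mul_le_mul_of_nonneg_left ?_ h0.le
          rw [Finset.sum_boole]
          have hs : ∀ a y, s a ≠ Sum.inr (i, y) := by
            intro a y ha
            refine h0.ne' (Finset.prod_eq_zero (Finset.mem_univ a) ?_)
            rw [ha]
            simp [atomMassOff]
          exact_mod_cast mul_card_bothCorrect_le hZ A i s hs
    _ = (1 - 2 * ℓ) ^ n * Fintype.card (Fin d → Fin m) := by
        rw [← Finset.sum_mul, ← sum_atomMassOff ℓ i, Fintype.sum_pow]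
    _ ≤ 1 * Fintype.card (Fin d → Fin m) := by
        gcongr
        exact pow_le_one₀ (by linarith) (by linarith)
    _ = _ := one_mul _

/-- Some choice of the parameters is unlucky for all sample sizes below `N` at once. -/
theorem exists_forall_le_expRobustLoss (hm : 0 < m) (hℓ : 0 ≤ ℓ) (hd : 2 * (d * ℓ) ≤ 1)
    (hℓ1 : 2 * ℓ ≤ 1)
    (hZ : ∀ f i κ κ', BothCorrect p r Z f i κ → BothCorrect p r Z f i κ' → κ = κ')
    (A : LearningAlgorithm d) (N : ℕ) :
    ∃ k : Fin d → Fin m, ∀ n < N, ENNReal.ofReal (d * ℓ * ((1 - 2 * ℓ) ^ n - N / m)) ≤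
      expRobustLoss p r A (atomicMeasure (atomMass ℓ) (atomExample H Z k)) n := by
  classical
  have hm' : (0 : ℝ) < m := by exact_mod_cast hm
  have : Nonempty (Fin d → Fin m) := ⟨fun _ => ⟨0, hm⟩⟩
  have hl0 : ∀ k n i, 0 ≤ luckyProb p r ℓ H Z A k n i := fun k n i =>
    Finset.sum_nonneg fun s _ => mul_nonneg
      (Finset.prod_nonneg fun a _ => atomMassOff_nonneg hℓ hd i _) (by split_ifs <;> norm_num)
  have havg : ∑ k, ∑ n ∈ Finset.range N, ∑ i, luckyProb p r ℓ H Z A k n i ≤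
      ∑ _k : Fin d → Fin m, (N * (d / m) : ℝ) := by
    rw [Finset.sum_comm]
    calc _ ≤ ∑ n ∈ Finset.range N, ∑ i : Fin d, (Fintype.card (Fin d → Fin m) / m : ℝ) := by
          refine Finset.sum_le_sum fun n _ => ?_
          rw [Finset.sum_comm]
          refine Finset.sum_le_sum fun i _ => ?_
          rw [le_div_iff₀' hm']
          exact mul_sum_luckyProb_le hℓ hd hℓ1 hZ A n i
      _ = _ := by
          simp only [Finset.sum_const, Finset.card_range, Finset.card_univ, Fintype.card_fin,
            nsmul_eq_mul]
          ring
  obtain ⟨k, -, hk⟩ := Finset.exists_le_of_sum_le Finset.univ_nonempty havg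
  refine ⟨k, fun n hn => le_trans (ENNReal.ofReal_le_ofReal ?_)
    (ofReal_le_expRobustLoss hℓ hd A k n)⟩
  have h1 : ∑ i, luckyProb p r ℓ H Z A k n i ≤ N * (d / m) :=
    (Finset.single_le_sum (f := fun n => ∑ i, luckyProb p r ℓ H Z A k n i)
      (fun n _ => Finset.sum_nonneg fun i _ => hl0 k n i) (Finset.mem_range.2 hn)).trans hk
  rw [Finset.sum_sub_distrib, Finset.sum_const, Finset.card_univ, Fintype.card_fin, nsmul_eq_mul]
  have h2 := mul_le_mul_of_nonneg_left h1 hℓ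
  calc d * ℓ * ((1 - 2 * ℓ) ^ n - N / m)
      = ℓ * (d * (1 - 2 * ℓ) ^ n) - ℓ * (N * (d / m)) := by ring
    _ ≤ _ := by linarith

end NoFreeLunch

/-! ### Robust separability of tight configurations -/

section LpBall

variable {d : ℕ} {p : ℝ≥0∞} {t : ℝ}

/-- For `p > 1`, the sum of the coordinates has a unique minimiser on an `ℓ_p` ball, the constant
vector: for finite `p` this is the equality case of Bernoulli's inequality. -/
lemma eq_neg_of_sum_le [Fact (1 ≤ p)] (hp : 1 < p) (ht : 0 < t) {z : Fin d → ℝ}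
    (hz : ‖WithLp.toLp p z‖ ≤ ‖WithLp.toLp p (fun _ : Fin d => t)‖)
    (hsum : ∑ j, z j ≤ -(d * t)) (j : Fin d) : z j = -t := by
  suffices habs : ∀ j, |z j| ≤ t by
    have h0 : ∀ j ∈ Finset.univ, 0 ≤ z j + t := fun j _ => by
      have := (abs_le.1 (habs j)).1
      linarith
    have h1 : ∑ j, (z j + t) = 0 := by
      refine le_antisymm ?_ (Finset.sum_nonneg h0)
      rw [Finset.sum_add_distrib, Finset.sum_const, Finset.card_univ, Fintype.card_fin,
        nsmul_eq_mul]
      linarith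
    have := (Finset.sum_eq_zero_iff_of_nonneg h0).1 h1 j (Finset.mem_univ j)
    linarith
  rcases eq_or_ne p ⊤ with rfl | hptop
  · intro j
    have : Nonempty (Fin d) := ⟨j⟩
    have h1 := (PiLp.norm_apply_le (WithLp.toLp ⊤ z) j).trans hz
    rw [PiLp.norm_eq_ciSup] at h1
    simpa [abs_of_pos ht] using h1
  · have hP : 1 < p.toReal := by
      rw [← ENNReal.toReal_one]
      exact (ENNReal.toReal_lt_toReal ENNReal.one_ne_top hptop).2 hp
    set q := p.toReal
    have hq0 : 0 < q := by linarith
    rw [PiLp.norm_eq_sum hq0, PiLp.norm_eq_sum hq0,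
      Real.rpow_le_rpow_iff (by positivity) (by positivity) (by positivity)] at hz
    simp only [Real.norm_eq_abs, abs_of_pos ht, Finset.sum_const, Finset.card_univ,
      Fintype.card_fin, nsmul_eq_mul] at hz
    have hbern : ∀ j, 0 ≤ (|z j| / t) ^ q - (1 + q * (|z j| / t - 1)) := by
      intro j
      have h1 := one_add_mul_self_le_rpow_one_add (s := |z j| / t - 1)
        (by have : 0 ≤ |z j| / t := by positivity
            linarith) hP.le
      rw [add_sub_cancel] at h1
      linarith
    have h1 : ∑ j, (|z j| / t) ^ q ≤ d := by
      simp only [Real.div_rpow (abs_nonneg _) ht.le, ← Finset.sum_div]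
      rw [div_le_iff₀ (by positivity)]
      exact hz
    have h2 : (d : ℝ) ≤ ∑ j, |z j| / t := by
      rw [← Finset.sum_div, le_div_iff₀ ht]
      have := Finset.sum_le_sum fun (j : Fin d) (_ : j ∈ Finset.univ) => neg_abs_le (z j)
      rw [Finset.sum_neg_distrib] at this
      linarith
    have h3 : ∑ j, ((|z j| / t) ^ q - (1 + q * (|z j| / t - 1))) = 0 := by
      refine le_antisymm ?_ (Finset.sum_nonneg fun j _ => hbern j)
      rw [Finset.sum_sub_distrib, Finset.sum_add_distrib, ← Finset.mul_sum,
        Finset.sum_sub_distrib]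
      simp only [Finset.sum_const, Finset.card_univ, Fintype.card_fin, nsmul_eq_mul, mul_one]
      nlinarith
    intro j
    have h4 := (Finset.sum_eq_zero_iff_of_nonneg fun j _ => hbern j).1 h3 j (Finset.mem_univ j)
    by_contra hne
    have h5 := one_add_mul_self_lt_rpow_one_add (s := |z j| / t - 1) (p := q)
      (by have : 0 ≤ |z j| / t := by positivity
          linarith)
      (by rw [sub_ne_zero, ne_eq, div_eq_one_iff_eq ht.ne']
          exact fun h => hne h.le) hP
    rw [add_sub_cancel] at h5
    linarith

/-- Tilting the functional `∑ z j` by `η a` lowers its minimum over the `ℓ_p` ball by `o(η)`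
relative to the value at the unperturbed minimiser, uniformly in `a`. -/
lemma exists_forall_pos_of_tilt [Fact (1 ≤ p)] (hp : 1 < p) (ht : 0 < t) {B c : ℝ} (hc : 0 < c) :
    ∃ η₀ : ℝ, 0 < η₀ ∧ ∀ η, 0 < η → η ≤ η₀ → ∀ a : Fin d → ℝ, (∀ j, |a j| ≤ B) →
      ∀ z : Fin d → ℝ, ‖WithLp.toLp p z‖ ≤ ‖WithLp.toLp p (fun _ : Fin d => t)‖ →
        0 < ∑ j, (t + z j) + η * (∑ j, a j * (t + z j) + c) := by
  set R := ‖WithLp.toLp p (fun _ : Fin d => t)‖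
  have hmin : ∀ z : Fin d → ℝ, ‖WithLp.toLp p z‖ ≤ R → ∑ j, (t + z j) ≤ 0 →
      ∀ j, z j = -t := by
    intro z hz hsum
    refine eq_neg_of_sum_le hp ht hz ?_
    rw [Finset.sum_add_distrib, Finset.sum_const, Finset.card_univ, Fintype.card_fin,
      nsmul_eq_mul] at hsum
    linarith
  have : ProperSpace (PiLp p fun _ : Fin d => ℝ) := FiniteDimensional.proper ℝ _
  -- near the minimiser the constant `c` wins; the rest of the ball is the compact set `K`
  let h : (PiLp p fun _ : Fin d => ℝ) → ℝ := fun z => B * ∑ j, |t + z j|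
  have hh : Continuous h := by fun_prop
  let K : Set (PiLp p fun _ : Fin d => ℝ) := Metric.closedBall 0 R ∩ {z | c ≤ h z}
  have hK : IsCompact K :=
    (isCompact_closedBall 0 R).inter_right (isClosed_le continuous_const hh)
  have hpos : ∀ z ∈ K, 0 < ∑ j, (t + z j) := by
    rintro z ⟨hz, hcz⟩
    by_contra! hle
    have hz0 := hmin (WithLp.ofLp z) (by simpa using hz) hle
    have : h z = 0 := by simp [h, hz0]
    have : c ≤ h z := hcz
    linarith
  have hG : ContinuousOn (fun z : PiLp p fun _ : Fin d => ℝ => ∑ j, (t + z j)) K := by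
    fun_prop
  obtain ⟨g, hg0, hg⟩ : ∃ g : ℝ, 0 < g ∧ ∀ z ∈ K, g ≤ ∑ j, (t + z j) := by
    rcases K.eq_empty_or_nonempty with he | hne
    · exact ⟨1, one_pos, by simp [he]⟩
    · obtain ⟨z, hz, hzmin⟩ := hK.exists_isMinOn hne hG
      exact ⟨_, hpos z hz, fun z' hz' => hzmin hz'⟩
  obtain ⟨C, hC⟩ := hK.exists_bound_of_continuousOn hh.continuousOn
  refine ⟨g / (|C| + 1), by positivity, fun η hη hηle a ha z hz => ?_⟩
  have hlow : -h (WithLp.toLp p z) ≤ ∑ j, a j * (t + z j) := by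
    simp only [h, Finset.mul_sum, ← Finset.sum_neg_distrib]
    refine Finset.sum_le_sum fun j _ => ?_
    have h1 := neg_abs_le (a j * (t + z j))
    rw [abs_mul] at h1
    have h2 := mul_le_mul_of_nonneg_right (ha j) (abs_nonneg (t + z j))
    linarith
  by_cases hzK : c ≤ h (WithLp.toLp p z)
  · have hmem : WithLp.toLp p z ∈ K := ⟨by simpa using hz, hzK⟩
    have h1 : g ≤ ∑ j, (t + z j) := hg _ hmem
    have h2 : h (WithLp.toLp p z) ≤ |C| :=
      (le_abs_self _).trans ((hC _ hmem).trans (le_abs_self C))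
    rw [le_div_iff₀ (by positivity)] at hηle
    have h3 : η * (-|C| + c) ≤ η * (∑ j, a j * (t + z j) + c) :=
      mul_le_mul_of_nonneg_left (by linarith) hη.le
    have h4 : 0 < η * c := by positivity
    linarith
  · push Not at hzK
    have h1 : 0 ≤ ∑ j, (t + z j) := by
      by_contra! hlt
      have hz0 := hmin z hz hlt.le
      simp [hz0] at hlt
    have h2 : 0 < η * (∑ j, a j * (t + z j) + c) := mul_pos hη (by linarith)
    linarith

end LpBall

/-! ### The hard distributions -/

section HardConfiguration

variable {d m : ℕ}

/-- The vector with all coordinates one. -/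
noncomputable def allOnes (d : ℕ) : Point d := WithLp.toLp 2 fun _ => 1

lemma inner_allOnes (x : Point d) : ⟪x, allOnes d⟫ = ∑ j, x j := by
  simp [allOnes, PiLp.inner_apply]

lemma norm_allOnes_sq : ‖allOnes d‖ ^ 2 = d := by
  rw [← real_inner_self_eq_norm_sq, inner_allOnes]
  simp [allOnes]

/-- The heavy example of label `y`, far away from the decision boundary. -/
noncomputable def heavyExample (t : ℝ) (y : Label) : Example d :=
  ((((y : ℤ) : ℝ) * (3 * t)) • allOnes d, y)

/-- The light example of label `y` of the coordinate `i` with parameter `κ`: the decision boundary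
passes through `t e_i + η κ 1`, and the two light examples lie opposite to each other, little
farther from this point than the robustness radius, which is the `ℓ_p` norm of `t 1`. -/
noncomputable def lightExample (t η : ℝ) (κ : Fin m) (i : Fin d) (y : Label) : Example d :=
  (EuclideanSpace.single i t + (η * (κ : ℕ) + ((y : ℤ) : ℝ) * (t + η / 2)) • allOnes d, y)

/-- The relative tilt of the separating hyperplane for the parameters `k`. -/
noncomputable def tilt (t : ℝ) (k : Fin d → Fin m) (j : Fin d) : ℝ :=
  (∑ i, ((k i : ℕ) : ℝ) - d * (k j : ℕ)) / t

/-- The normal vector of the separating hyperplane for the parameters `k`. -/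
noncomputable def hardNormal (t η : ℝ) (k : Fin d → Fin m) : Point d :=
  WithLp.toLp 2 fun j => 1 + η * tilt t k j

/-- The offset of the separating hyperplane for the parameters `k`. -/
noncomputable def hardOffset (t η : ℝ) (k : Fin d → Fin m) : ℝ :=
  t + η * ∑ i, ((k i : ℕ) : ℝ)

variable {t η : ℝ} {k : Fin d → Fin m}

lemma sum_tilt : ∑ j, tilt t k j = 0 := by
  simp only [tilt]
  rw [← Finset.sum_div, Finset.sum_sub_distrib, ← Finset.mul_sum]
  simp

lemma sum_param_le : ∑ i, ((k i : ℕ) : ℝ) ≤ d * m := by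
  calc ∑ i, ((k i : ℕ) : ℝ) ≤ ∑ _i : Fin d, (m : ℝ) :=
        Finset.sum_le_sum fun i _ => by exact_mod_cast (k i).2.le
    _ = d * m := by simp

lemma sum_param_nonneg : 0 ≤ ∑ i, ((k i : ℕ) : ℝ) :=
  Finset.sum_nonneg fun _ _ => Nat.cast_nonneg _

lemma abs_tilt_le (ht : 0 < t) (j : Fin d) : |tilt t k j| ≤ d * m / t := by
  rw [tilt, abs_div, abs_of_pos ht]
  gcongr
  have h1 := sum_param_le (k := k)
  have h2 := sum_param_nonneg (k := k)
  have h3 : (d : ℝ) * (k j : ℕ) ≤ d * m := by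
    gcongr
    exact (k j).2.le
  have h4 : (0 : ℝ) ≤ (d : ℝ) * (k j : ℕ) := by positivity
  rw [abs_le]
  constructor <;> linarith

lemma inner_hardNormal_allOnes : ⟪hardNormal t η k, allOnes d⟫ = d := by
  rw [inner_allOnes]
  simp [hardNormal, Finset.sum_add_distrib, ← Finset.mul_sum, sum_tilt]

lemma signedMargin_heavyExample (y : Label) :
    signedMargin (hardNormal t η k) (hardOffset t η k) (heavyExample t y) =
      3 * t * d - ((y : ℤ) : ℝ) * hardOffset t η k := by
  simp only [signedMargin, heavyExample, real_inner_smul_right, inner_hardNormal_allOnes]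
  linear_combination (3 * t * d) * label_mul_self y

lemma signedMargin_lightExample (ht : t ≠ 0) (i : Fin d) (y : Label) :
    signedMargin (hardNormal t η k) (hardOffset t η k) (lightExample t η (k i) i y) =
      d * (t + η / 2) := by
  simp only [signedMargin, lightExample, inner_add_right, real_inner_smul_right,
    inner_hardNormal_allOnes, EuclideanSpace.inner_single_right]
  have h1 : t * (1 + η * tilt t k i) = t + η * (∑ i, ((k i : ℕ) : ℝ) - d * (k i : ℕ)) := by
    rw [tilt]
    field_simp
  have h2 : t * (starRingEnd ℝ) ((hardNormal t η k).ofLp i) = t * (1 + η * tilt t k i) := rfl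
  rw [h2, h1, hardOffset]
  linear_combination (d * (t + η / 2)) * label_mul_self y

lemma norm_hardNormal_le (hη : ∀ j, |η * tilt t k j| ≤ 1 / 2) :
    ‖hardNormal t η k‖ ≤ 3 / 2 * ‖allOnes d‖ := by
  refine le_of_sq_le_sq ?_ (by positivity)
  rw [mul_pow, norm_allOnes_sq, EuclideanSpace.norm_sq_eq]
  calc ∑ j, ‖hardNormal t η k j‖ ^ 2 ≤ ∑ _j : Fin d, ((3 / 2) ^ 2 : ℝ) := by
        refine Finset.sum_le_sum fun j _ => ?_
        have h1 := abs_le.1 (hη j)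
        have h2 : hardNormal t η k j = 1 + η * tilt t k j := rfl
        rw [h2, Real.norm_eq_abs, sq_abs]
        nlinarith
    _ = _ := by simp; ring

lemma lpDist_add_smul_allOnes {p : ℝ≥0∞} [Fact (1 ≤ p)] (x : Point d) (a b : ℝ) :
    lpDist p (x + a • allOnes d) (x + b • allOnes d) =
      |a - b| * ‖WithLp.toLp p (fun _ : Fin d => (1 : ℝ))‖ := by
  rw [lpDist, add_sub_add_left_eq_sub, ← sub_smul, ← Real.norm_eq_abs, ← norm_smul]
  rfl

/-- The balls around light examples of opposite labels for different parameters intersect, so that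
a classifier is correct for at most one parameter. -/
lemma bothCorrect_lightExample_unique {p : ℝ≥0∞} [Fact (1 ≤ p)] {r : ℝ} (ht : 0 < t) (hη : 0 < η)
    (hηm : η * m ≤ t) (hr : t * ‖WithLp.toLp p (fun _ : Fin d => (1 : ℝ))‖ ≤ r)
    (f : Classifier d) (i : Fin d) (κ κ' : Fin m)
    (h : BothCorrect p r (lightExample t η) f i κ)
    (h' : BothCorrect p r (lightExample t η) f i κ') : κ = κ' := by
  wlog hlt : κ < κ' generalizing κ κ'
  · rcases lt_trichotomy κ κ' with h1 | h1 | h1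
    · exact this κ κ' h h' h1
    · exact h1
    · exact (this κ' κ h' h h1).symm
  exfalso
  have hball : ∀ a b : ℝ, |a - b| ≤ t → lpDist p (EuclideanSpace.single i t + a • allOnes d)
      (EuclideanSpace.single i t + b • allOnes d) ≤ r := fun a b hab => by
    rw [lpDist_add_smul_allOnes]
    exact (mul_le_mul_of_nonneg_right hab (norm_nonneg _)).trans hr
  have hκ : ((κ : ℕ) : ℝ) + 1 ≤ (κ' : ℕ) := by exact_mod_cast hlt
  have hκm : ((κ' : ℕ) : ℝ) ≤ m := by exact_mod_cast κ'.2.le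
  have hκ0 : (0 : ℝ) ≤ (κ : ℕ) := Nat.cast_nonneg _
  have h1 : f (EuclideanSpace.single i t + (η * (κ : ℕ) + η / 2) • allOnes d) = 1 :=
    h 1 _ (hball _ _ (by
      rw [abs_le]
      push_cast
      constructor <;> linarith))
  have h2 : f (EuclideanSpace.single i t + (η * (κ : ℕ) + η / 2) • allOnes d) = -1 :=
    h' (-1) _ (hball _ _ (by
      rw [abs_le]
      push_cast
      constructor <;> nlinarith))
  rw [h1] at h2
  exact absurd h2 (by decide)

lemma norm_heavyExample_le (ht : 0 < t) (y : Label) :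
    ‖(heavyExample t y : Example d).1‖ ≤ 3 * t * ‖allOnes d‖ := by
  rw [heavyExample, norm_smul, Real.norm_eq_abs, abs_mul, abs_label, one_mul,
    abs_of_pos (by positivity)]

lemma norm_lightExample_le (ht : 0 < t) (hη : 0 < η) (hηm : η * (m + 1) ≤ t) (κ : Fin m)
    (i : Fin d) (y : Label) :
    ‖(lightExample t η κ i y).1‖ ≤ 3 * t * ‖allOnes d‖ := by
  have hs : 1 ≤ ‖allOnes d‖ := by
    rw [← one_le_sq_iff₀ (norm_nonneg _), norm_allOnes_sq]
    exact_mod_cast i.pos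
  have h1 : |η * (κ : ℕ) + ((y : ℤ) : ℝ) * (t + η / 2)| ≤ 2 * t := by
    refine (abs_add_le _ _).trans ?_
    rw [abs_mul ((y : ℤ) : ℝ), abs_label, one_mul, abs_of_nonneg (by positivity),
      abs_of_nonneg (by positivity)]
    have hκm : ((κ : ℕ) : ℝ) ≤ m := by exact_mod_cast κ.2.le
    nlinarith
  refine (norm_add_le _ _).trans ?_
  rw [norm_smul, Real.norm_eq_abs, PiLp.norm_single, Real.norm_of_nonneg ht.le]
  nlinarith [mul_le_mul_of_nonneg_right h1 (norm_nonneg (allOnes d))]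

lemma robustlyCorrect_of_le_signedMargin {p : ℝ≥0∞} {r c b : ℝ} {w : Point d} {e : Example d}
    (he : c ≤ signedMargin w b e)
    (hw : ∀ z : Fin d → ℝ, ‖WithLp.toLp p z‖ ≤ r →
      0 < c + ((e.2 : ℤ) : ℝ) * ⟪w, WithLp.toLp 2 z⟫) :
    RobustlyCorrect p r (linearClassifier w b) e := by
  intro x' hx'
  have h1 := hw _ hx'
  rw [WithLp.toLp_ofLp, inner_sub_right] at h1
  refine linearClassifier_eq_of_signedMargin_pos (e := (x', e.2)) ?_
  rw [signedMargin] at he ⊢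
  linarith

/-- For every number `m` of parameters there is a configuration of atoms whose distributions all
belong to the family, although a classifier can be robustly correct on both light examples of a
coordinate for only one value of the parameter. -/
theorem exists_hard_configuration {p : ℝ≥0∞} {r ρ : ℝ} (hd : 1 ≤ d) (hp : 1 < p) (hr : 0 < r)
    (hρ : 9 ≤ ρ) (m : ℕ) :
    ∃ (H : Label → Example d) (Z : Fin m → Fin d → Label → Example d),
      (∀ f i κ κ', BothCorrect p r Z f i κ → BothCorrect p r Z f i κ' → κ = κ') ∧
      ∀ (q : Atom d → ℝ), (∀ j, 0 < q j) → ∑ j, q j = 1 → ∀ k,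
        atomicMeasure q (atomExample H Z k) ∈ separatedFamily d p r ρ := by
  have : Fact (1 ≤ p) := ⟨hp.le⟩
  have : Nonempty (Fin d) := ⟨⟨0, hd⟩⟩
  have hd0 : (0 : ℝ) < d := by exact_mod_cast hd
  have hd1 : (1 : ℝ) ≤ d := by exact_mod_cast hd
  set s₁ := ‖WithLp.toLp p (fun _ : Fin d => (1 : ℝ))‖ with hs₁
  have hs₁0 : 0 < s₁ := by
    rw [hs₁, norm_pos_iff]
    intro h0
    have := congrArg (fun z : PiLp p fun _ : Fin d => ℝ => z ⟨0, hd⟩) h0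
    simp at this
  obtain ⟨t, ht, htr⟩ : ∃ t : ℝ, 0 < t ∧ t * s₁ = r :=
    ⟨r / s₁, by positivity, by field_simp⟩
  have hball : ‖WithLp.toLp p (fun _ : Fin d => t)‖ = r := by
    have h1 : (WithLp.toLp p fun _ : Fin d => t) = t • WithLp.toLp p fun _ : Fin d => (1 : ℝ) := by
      ext j
      simp
    rw [h1, norm_smul, Real.norm_of_nonneg ht.le, htr]
  obtain ⟨η₀, hη₀, htilt⟩ := exists_forall_pos_of_tilt (d := d) hp ht (B := d * m / t)
    (by positivity : 0 < (d : ℝ) / 2)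
  obtain ⟨η, hη, hηη₀, hηd⟩ : ∃ η : ℝ, 0 < η ∧ η ≤ η₀ ∧ η * (d * (m + 1)) ≤ t / 2 :=
    ⟨min η₀ (t / 2 / (d * (m + 1))), lt_min hη₀ (by positivity), min_le_left _ _, by
      rw [← le_div_iff₀ (by positivity)]
      exact min_le_right _ _⟩
  have hηdm : η * (d * m) + η * d ≤ t / 2 := by linarith
  have hηm : η * (m + 1) ≤ t := by
    have : (m + 1 : ℝ) ≤ d * (m + 1) := by
      have : (0 : ℝ) ≤ m := Nat.cast_nonneg m
      nlinarith
    nlinarith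
  refine ⟨heavyExample t, lightExample t η, fun f i κ κ' h h' =>
    bothCorrect_lightExample_unique ht hη (by nlinarith) htr.le f i κ κ' h h', ?_⟩
  intro q hq hq1 k
  set w := hardNormal t η k with hwdef
  set b := hardOffset t η k with hbdef
  have hw0 : w ≠ 0 := by
    intro h0
    have := inner_hardNormal_allOnes (t := t) (η := η) (k := k)
    rw [← hwdef, h0, inner_zero_left] at this
    exact hd0.ne this
  have hs := norm_allOnes_sq (d := d)
  set s := ‖allOnes d‖ with hsdef
  have hs0 : 0 < s := by
    rw [hsdef, norm_pos_iff]
    intro h0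
    rw [hsdef, h0, norm_zero] at hs
    norm_num at hs
    exact hd0.ne hs
  have hmarg : ∀ j, d * (t + η / 2) ≤
      signedMargin w b (atomExample (heavyExample t) (lightExample t η) k j) := by
    rintro (y | ⟨i, y⟩)
    · rw [atomExample, signedMargin_heavyExample]
      have h1 := sum_param_nonneg (k := k)
      have h2 := sum_param_le (k := k)
      have h3 : |((y : ℤ) : ℝ) * hardOffset t η k| ≤ t + η * (d * m) := by
        rw [abs_mul, abs_label, one_mul, hardOffset, abs_of_nonneg (by positivity)]
        gcongr
      have h4 := (le_abs_self _).trans h3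
      nlinarith
    · rw [atomExample, signedMargin_lightExample ht.ne']
  have hnorm : ∀ j,
      ‖(atomExample (heavyExample t) (lightExample t η) k j).1‖ ≤ 3 * t * s := by
    rintro (y | ⟨i, y⟩)
    · exact norm_heavyExample_le ht y
    · exact norm_lightExample_le ht hη hηm _ i y
  have hwnorm : ‖w‖ ≤ 3 / 2 * s := norm_hardNormal_le fun j => by
    rw [abs_mul, abs_of_pos hη]
    have h1 := mul_le_mul_of_nonneg_left (abs_tilt_le (k := k) ht j) hη.le
    refine h1.trans ?_
    rw [← mul_div_assoc, div_le_iff₀ ht]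
    nlinarith
  refine atomicMeasure_mem_separatedFamily (by linarith) hq hq1 (fun y => ⟨Sum.inl y, rfl⟩)
    (w := w) (b := b) (g := 2 / 3 * t * s) hw0 (by positivity) (fun j => ?_) (fun j => ?_)
    (fun i j => ?_)
  · refine le_trans ?_ (hmarg j)
    have h1 := mul_le_mul_of_nonneg_left hwnorm (by positivity : 0 ≤ 2 / 3 * t * s)
    have h2 : 2 / 3 * t * s * (3 / 2 * s) = t * d := by
      rw [← hs]
      ring
    nlinarith
  · refine robustlyCorrect_of_le_signedMargin (hmarg j) fun z hz => ?_
    generalize (atomExample (heavyExample t) (lightExample t η) k j).2 = y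
    have hz' : ‖WithLp.toLp p (((y : ℤ) : ℝ) • z)‖ ≤
        ‖WithLp.toLp p (fun _ : Fin d => t)‖ := by
      rw [WithLp.toLp_smul, norm_smul, Real.norm_eq_abs, abs_label, one_mul, hball]
      exact hz
    have h1 := htilt η hη hηη₀ (tilt t k) (abs_tilt_le ht) _ hz'
    have h2 : ⟪w, WithLp.toLp 2 z⟫ = ∑ i, z i + η * ∑ i, tilt t k i * z i := by
      rw [hwdef, hardNormal, PiLp.inner_apply, Finset.mul_sum, ← Finset.sum_add_distrib]
      refine Finset.sum_congr rfl fun i _ => ?_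
      simp only [RCLike.inner_apply, conj_trivial]
      ring
    have h3 : ∑ i, (t + (((y : ℤ) : ℝ) • z) i) = d * t + ((y : ℤ) : ℝ) * ∑ i, z i := by
      rw [Finset.sum_add_distrib, Finset.mul_sum]
      simp
    have h4 : ∑ i, tilt t k i * (t + (((y : ℤ) : ℝ) • z) i) =
        ((y : ℤ) : ℝ) * ∑ i, tilt t k i * z i := by
      simp only [mul_add, Finset.sum_add_distrib, ← Finset.sum_mul, sum_tilt, zero_mul, zero_add,
        Finset.mul_sum, Pi.smul_apply, smul_eq_mul]
      exact Finset.sum_congr rfl fun i _ => by ring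
    rw [h3, h4] at h1
    rw [h2]
    linarith
  · calc dist _ _ ≤ 3 * t * s + 3 * t * s :=
          (dist_le_norm_add_norm _ _).trans (add_le_add (hnorm i) (hnorm j))
      _ = 9 * (2 / 3 * t * s) := by ring
      _ ≤ ρ * (2 / 3 * t * s) := by gcongr

end HardConfiguration

/-! ### The sample complexity of robust learning -/

/-- Robust learning needs a number of samples that is linear in the dimension: with light atoms of
total mass `C ε`, where `2 < C < 1 / ε₀`, missing most of the coordinates costs more than `ε`. -/
theorem exists_le_robustSampleComplexity {ε₀ : ℝ} (h0 : 0 < ε₀) (h1 : ε₀ < 1 / 2) :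
    ∃ c : ℝ, 0 < c ∧ ∀ (d : ℕ) (p : ℝ≥0∞) (r ρ : ℝ), 1 ≤ d → 1 < p → 0 < r → 9 ≤ ρ →
      ∀ (A : LearningAlgorithm d) (ε : ℝ), 0 < ε → ε ≤ ε₀ → ∃ D ∈ separatedFamily d p r ρ,
        ENNReal.ofReal (c * d / ε) ≤ (robustSampleComplexity p r A D ε : ℝ≥0∞) := by
  obtain ⟨C, hC2, hC1⟩ : ∃ C : ℝ, 2 < C ∧ C * ε₀ < 1 := by
    refine ⟨1 + 1 / (2 * ε₀), ?_, ?_⟩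
    · have : 1 < 1 / (2 * ε₀) := by
        rw [lt_div_iff₀ (by positivity)]
        linarith
      linarith
    · rw [add_mul, one_mul, div_mul_eq_mul_div, one_mul]
      have : ε₀ / (2 * ε₀) = 1 / 2 := by field_simp
      linarith
  have hC0 : 0 < C := by linarith
  -- `δ` is the slack in `C / 2 > 1`; half of it pays for seen coordinates, half for luck
  set δ := 1 - 2 / C with hδ
  have hδ0 : 0 < δ := by
    rw [hδ, sub_pos, div_lt_one hC0]
    exact hC2
  refine ⟨δ / (2 * C), by positivity, ?_⟩
  intro d p r ρ hd hp hr hρ A ε hε hεε₀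
  have hd0 : (0 : ℝ) < d := by exact_mod_cast hd
  have hd1 : (1 : ℝ) ≤ d := by exact_mod_cast hd
  set N := ⌈δ / (2 * C) * d / ε⌉₊ with hN
  obtain ⟨m, hm⟩ := exists_nat_gt (2 * N / δ)
  have hm0 : (0 : ℝ) < m := lt_of_le_of_lt (by positivity) hm
  obtain ⟨H, Z, hZ, hfam⟩ := exists_hard_configuration hd hp hr hρ m
  set ℓ := C * ε / (2 * d) with hℓ
  have hℓ0 : 0 < ℓ := by positivity
  have hdℓ : 2 * (d * ℓ) = C * ε := by
    rw [hℓ]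
    field_simp
  have hCε : C * ε < 1 := lt_of_le_of_lt (by gcongr) hC1
  have h2ℓ : 2 * ℓ ≤ C * ε := by
    rw [← hdℓ]
    nlinarith
  obtain ⟨k, hk⟩ := exists_forall_le_expRobustLoss (p := p) (r := r) (H := H)
    (by exact_mod_cast hm0) hℓ0.le (by linarith) (by linarith) hZ A N
  refine ⟨_, hfam (atomMass ℓ) ?_ (sum_atomMass ℓ) k, ?_⟩
  · rintro (y | a)
    · simp only [atomMass]
      linarith
    · exact hℓ0
  have hge : (N : ℕ∞) ≤
      robustSampleComplexity p r A (atomicMeasure (atomMass ℓ) (atomExample H Z k)) ε := by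
    refine le_iInf₂ fun n hn => ?_
    by_contra! hlt
    have hlt' : n < N := by exact_mod_cast hlt
    have h2 := (hk n hlt').trans hn
    rw [ENNReal.ofReal_le_ofReal_iff hε.le] at h2
    have h3 : (n : ℝ) < δ / (2 * C) * d / ε := Nat.lt_ceil.1 hlt'
    have h4 : 1 - n * (2 * ℓ) ≤ (1 - 2 * ℓ) ^ n := by
      have := one_add_mul_le_pow (a := -(2 * ℓ)) (by linarith) n
      rw [← sub_eq_add_neg] at this
      linarith
    have h5 : n * (2 * ℓ) < δ / 2 := by
      rw [lt_div_iff₀ hε] at h3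
      calc n * (2 * ℓ) = n * ε * (C / d) := by rw [hℓ]; field_simp
        _ < δ / (2 * C) * d * (C / d) := by gcongr
        _ = δ / 2 := by field_simp
    have h6 : (N : ℝ) / m < δ / 2 := by
      rw [div_lt_iff₀ hδ0] at hm
      rw [div_lt_iff₀ hm0]
      linarith
    have h7 : 2 / C < (1 - 2 * ℓ) ^ n - N / m := by linarith
    have h8 : d * ℓ * (2 / C) = ε := by
      rw [hℓ]
      field_simp
    have h9 := mul_lt_mul_of_pos_left h7 (by positivity : 0 < d * ℓ)
    linarith
  calc ENNReal.ofReal (δ / (2 * C) * d / ε) ≤ ENNReal.ofReal N :=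
        ENNReal.ofReal_le_ofReal (Nat.le_ceil _)
    _ = ((N : ℕ∞) : ℝ≥0∞) := by rw [ENat.toENNReal_coe, ENNReal.ofReal_natCast]
    _ ≤ _ := ENat.toENNReal_le.2 hge

theorem mainTheorem2 :
    (∀ ε₀ : ℝ, 0 < ε₀ → ε₀ < 1 / 2 →
      ∃ c : ℝ, 0 < c ∧
        ∀ (d : ℕ) (p : ℝ≥0∞) (r ρ : ℝ), 1 ≤ d → 1 < p → 0 < r → 20 < ρ →
          ∀ (A : LearningAlgorithm d) (ε : ℝ), 0 < ε → ε ≤ ε₀ →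
            ∃ D ∈ separatedFamily d p r ρ,
              ENNReal.ofReal (c * d / ε) ≤ (robustSampleComplexity p r A D ε : ℝ≥0∞)) ∧
    (∃ c' : ℝ, 0 < c' ∧
      ∀ (d : ℕ) (p : ℝ≥0∞) (r ρ : ℝ), 1 ≤ d → 1 < p → 0 < r → 20 < ρ →
        ∀ M : LearningAlgorithm d, IsMaxMarginAlgorithm M →
          ∀ D ∈ separatedFamily d p r ρ, ∀ ε : ℝ, 0 < ε →
            (stdSampleComplexity M D ε : ℝ≥0∞) ≤ ENNReal.ofReal (c' * ρ ^ 2 / ε)) := by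
  refine ⟨fun ε₀ h0 h1 => ?_, 1, one_pos, ?_⟩
  · obtain ⟨c, hc, h⟩ := exists_le_robustSampleComplexity h0 h1
    exact ⟨c, hc, fun d p r ρ hd hp hr hρ => h d p r ρ hd hp hr (by linarith)⟩
  · intro d p r ρ _ _ _ hρ M hM D hD ε hε
    rw [one_mul]
    exact stdSampleComplexity_le (by linarith) hD hM hε
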